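/- Let $m\ge 1$ and let $L$ be the $\mathbb{Q}$-Lie algebra with basis $x_1,\dots,x_m,y_1,\dots,y_m,e,f$ attached to the polynomial $x^m$: $e,f$ are central, $[x_i,x_j]=[y_i,y_j]=0$, and $[x_i,y_j]=\delta_{ij}\,e+K_{ij}\,f$, where $K$ is the companion matrix of $x^m$ (that is, $K_{i,i+1}=1$ and all other entries are $0$). Let $\mathbf G\subset\mathbf{GL}_{2m+2}$ be the algebraic automorphism group of $L$, a linear algebraic group over $\mathbb{Q}$ with $\mathbf G(k)=\mathrm{Aut}_k(k\otimes_{\mathbb Q}L)$ for every field extension $k/\mathbb Q$, realised with respect to the ordered basis $$\mathcal C=(x_1,y_m,x_2,y_{m-1},\dots,x_m,y_1,f,e),$$ matrices acting on coordinate row vectors from the right. Let $\mathbf G^\circ$ be its identity component and $\mathbf N$ the unipotent radical of $\mathbf G^\circ$. Then there is a reductive subgroup $\mathbf H\subset\mathbf G^\circ$ such that $\mathbf G^\circ=\mathbf N\rtimes\mathbf H$ as algebraic groups over $\mathbb Q$, and: 1. $\mathbf H\cong\mathbf{GL}_2\times\mathbf{GL}_1$ as algebraic groups over $\mathbb Q$,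 through the isomorphism given on points, over every commutative $\mathbb Q$-algebra, by $$(A,\mu)\longmapsto\mathrm{diag}\bigl(\mu^{m-1}A,\ \mu^{m-2}A,\ \dots,\ \mu A,\ A,\ \mu^m\det A,\ \mu^{m-1}\det A\bigr).$$ In particular, for every field extension $k/\mathbb Q$, $\mathbf H(k)$ consists exactly of these matrices with $A\in \mathrm{GL}_2(k)$, $\mu\in k^\times$. 2. For every field extension $k/\mathbb Q$, the group $\mathbf N(k)$ is generated by $\exp(\mathfrak n_0(k))$ and $\exp(k\xi_3)$. Here $\mathfrak n_0(k)$ is the set of all matrices $$\begin{pmatrix}T&Z\\0&0\end{pmatrix},\qquad T=\begin{pmatrix}0&X_2&X_3&\cdots&X_m\\&0&X_2&\ddots&\vdots\\&&\ddots&\ddots&X_3\\&&&0&X_2\\&&&&0\end{pmatrix},$$ with $X_2,\dots,X_m\in\mathfrak{sl}_2(k)$ and $Z$ an arbitrary $2m\times2$ matrix over $k$, and $\xi_3$ is the block diagonal matrix whose upper left $2m\times 2m$ part has the $2\times2$ blocks $\tfrac{3-m}{2}I_2,\tfrac{5-m}{2}I_2,\dots,\tfrac{m-1}{2}I_2$ on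 its first block superdiagonal and zeros elsewhere, and whose lower right $2\times2$ part is $\begin{pmatrix}0&1\\0&0\end{pmatrix}$. -/

import Mathlib

open scoped TensorProduct Matrix Kronecker

universe u

/-! ### Linear algebraic groups over the rational numbers -/

/-- A linear algebraic group over `ℚ`, realised as a closed subgroup scheme of `GL_ι`: its group of
`R`-points inside `GL_ι(R)`, for every commutative `ℚ`-algebra `R`, is cut out by one fixed set of
polynomials with rational coefficients in the matrix entries. -/
structure AlgSubgroup (ι : Type) [Fintype ι] [DecidableEq ι] where
  pts : ∀ (R : Type u) [CommRing R] [Algebra ℚ R], Subgroup (GL ι R)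
  exists_equations : ∃ S : Set (MvPolynomial (ι × ι) ℚ),
    ∀ (R : Type u) [CommRing R] [Algebra ℚ R] (g : GL ι R),
      g ∈ pts R ↔ ∀ p ∈ S, MvPolynomial.aeval (fun ij : ι × ι => g.val ij.1 ij.2) p = 0

section AlgebraicGroups

variable {ι : Type} [Fintype ι] [DecidableEq ι]

/-- The Zariski topology on `GL_ι(K)`, generated by the principal open sets. -/
@[reducible] def zariskiTopology (ι : Type) [Fintype ι] [DecidableEq ι] (K : Type u) [Field K] :
    TopologicalSpace (GL ι K) :=
  TopologicalSpace.generateFrom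
    {U | ∃ p : MvPolynomial (ι × ι) K,
      U = {g : GL ι K | MvPolynomial.eval (fun ij : ι × ι => g.val ij.1 ij.2) p ≠ 0}}

/-- All elements of a group of matrices are unipotent. -/
def IsUnipotentSubgroup {K : Type u} [Field K] (U : Subgroup (GL ι K)) : Prop :=
  ∀ g ∈ U, IsNilpotent (g.val - 1)

/-- `U` is a Zariski closed, connected, unipotent, normal subgroup of the matrix group `G` (both are
groups of points over a field `K`, which will be algebraically closed). -/
structure IsConnectedNormalUnipotent {K : Type u} [Field K] (G U : Subgroup (GL ι K)) : Prop where
  le : U ≤ G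
  normal : ∀ g ∈ G, ∀ n ∈ U, g * n * g⁻¹ ∈ U
  closed : @IsClosed (GL ι K) (zariskiTopology ι K) (U : Set (GL ι K))
  connected : @IsConnected (GL ι K) (zariskiTopology ι K) (U : Set (GL ι K))
  unipotent : IsUnipotentSubgroup U

namespace AlgSubgroup

/-- `G₀` is the identity component of `G`: over every algebraically closed field its points are the
connected component of `1` for the Zariski topology. (In characteristic zero a closed subgroup
scheme is reduced, so this determines `G₀`.) -/
def IsIdentityComponent (G G₀ : AlgSubgroup.{u} ι) : Prop :=
  ∀ (K : Type u) [Field K] [Algebra ℚ K] [IsAlgClosed K],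
    (G₀.pts K : Set (GL ι K)) =
      @connectedComponentIn (GL ι K) (zariskiTopology ι K) (G.pts K : Set (GL ι K)) 1

/-- `N` is the unipotent radical of `G`: the largest connected normal unipotent closed subgroup,
also after passing to any algebraically closed field. -/
def IsUnipotentRadical (G N : AlgSubgroup.{u} ι) : Prop :=
  (∀ (R : Type u) [CommRing R] [Algebra ℚ R],
    N.pts R ≤ G.pts R ∧ ∀ g ∈ G.pts R, ∀ n ∈ N.pts R, g * n * g⁻¹ ∈ N.pts R) ∧
  ∀ (K : Type u) [Field K] [Algebra ℚ K] [IsAlgClosed K],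
    IsConnectedNormalUnipotent (G.pts K) (N.pts K) ∧
    ∀ U : Subgroup (GL ι K), IsConnectedNormalUnipotent (G.pts K) U → U ≤ N.pts K

/-- `H` is (connected) reductive: it is connected, and over every algebraically closed field it has
no nontrivial connected normal unipotent closed subgroup. -/
def IsReductive (H : AlgSubgroup.{u} ι) : Prop :=
  ∀ (K : Type u) [Field K] [Algebra ℚ K] [IsAlgClosed K],
    @IsConnected (GL ι K) (zariskiTopology ι K) (H.pts K : Set (GL ι K)) ∧
    ∀ U : Subgroup (GL ι K), IsConnectedNormalUnipotent (H.pts K) U → U = ⊥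

/-- `G = N ⋊ H` as an internal semidirect product of algebraic groups, i.e. on `R`-points for every
commutative `ℚ`-algebra `R`. -/
def IsSemidirectProduct (G N H : AlgSubgroup.{u} ι) : Prop :=
  ∀ (R : Type u) [CommRing R] [Algebra ℚ R],
    N.pts R ≤ G.pts R ∧ H.pts R ≤ G.pts R ∧
    (∀ g ∈ G.pts R, ∀ n ∈ N.pts R, g * n * g⁻¹ ∈ N.pts R) ∧
    N.pts R ⊓ H.pts R = ⊥ ∧
    ∀ g ∈ G.pts R, ∃ n ∈ N.pts R, ∃ h ∈ H.pts R, g = n * h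

/-- An isomorphism of algebraic groups `GL₂ × GL₁ ≅ H` over `ℚ`: group isomorphisms on `R`-points,
natural in the commutative `ℚ`-algebra `R`. -/
structure IsoGLTwoGLOne (H : AlgSubgroup.{u} ι) where
  equiv : ∀ (R : Type u) [CommRing R] [Algebra ℚ R], (GL (Fin 2) R × Rˣ) ≃* H.pts R
  natural : ∀ (R S : Type u) [CommRing R] [Algebra ℚ R] [CommRing S] [Algebra ℚ S] (φ : R →ₐ[ℚ] S)
    (A : GL (Fin 2) R) (μ : Rˣ),
    (equiv S (Matrix.GeneralLinearGroup.map (φ : R →+* S) A, Units.map (φ : R →* S) μ) : GL ι S) =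
      Matrix.GeneralLinearGroup.map (φ : R →+* S) (equiv R (A, μ) : GL ι R)

end AlgSubgroup

/-! ### The algebraic automorphism group of a Lie algebra -/

section Aut

variable {L : Type} [LieRing L] [LieAlgebra ℚ L]

/-- The matrices, with respect to the basis `b`, of the `R`-linear Lie algebra automorphisms of
`R ⊗ L`. Matrices act on coordinate row vectors from the right, so the `i`-th row of the matrix of
`φ` holds the coordinates of the image of the `i`-th basis vector. -/
def autPoints (b : Module.Basis ι ℚ L) (R : Type u) [CommRing R] [Algebra ℚ R] :
    Subgroup (GL ι R) where
  carrier := {g | ∃ φ : (R ⊗[ℚ] L) ≃ₗ⁅R⁆ (R ⊗[ℚ] L),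
    ∀ i, φ (1 ⊗ₜ b i) = ∑ j, g.val i j • ((1 : R) ⊗ₜ[ℚ] b j)}
  one_mem' := ⟨LieEquiv.refl, fun i => by simp [Matrix.one_apply]⟩
  mul_mem' := by
    rintro g h ⟨φ, hφ⟩ ⟨ψ, hψ⟩
    refine ⟨φ.trans ψ, fun i => ?_⟩
    have : (φ.trans ψ) (1 ⊗ₜ b i) = ψ (φ (1 ⊗ₜ b i)) := rfl
    rw [this, hφ]
    have h2 : ∀ j, ψ (g.val i j • ((1 : R) ⊗ₜ[ℚ] b j)) = g.val i j • ψ ((1 : R) ⊗ₜ[ℚ] b j) :=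
      fun j => map_smul ψ.toLieHom _ _
    have h1 : ψ (∑ j, g.val i j • ((1 : R) ⊗ₜ[ℚ] b j))
        = ∑ j, ψ (g.val i j • ((1 : R) ⊗ₜ[ℚ] b j)) :=
      map_sum ψ.toLieHom _ _
    rw [h1]
    simp only [h2, hψ, Units.val_mul, Matrix.mul_apply, Finset.sum_smul, Finset.smul_sum,
      smul_smul]
    rw [Finset.sum_comm]
  inv_mem' := by
    rintro g ⟨φ, hφ⟩
    refine ⟨φ.symm, fun i => ?_⟩
    apply φ.injective
    have h0 : φ (φ.symm (1 ⊗ₜ b i)) = 1 ⊗ₜ b i := LieEquiv.apply_symm_apply φ _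
    refine h0.trans ?_
    have h2 : ∀ j, φ ((g⁻¹).val i j • ((1 : R) ⊗ₜ[ℚ] b j))
        = (g⁻¹).val i j • φ ((1 : R) ⊗ₜ[ℚ] b j) :=
      fun j => map_smul φ.toLieHom _ _
    have h1 : φ (∑ j, (g⁻¹).val i j • ((1 : R) ⊗ₜ[ℚ] b j))
        = ∑ j, φ ((g⁻¹).val i j • ((1 : R) ⊗ₜ[ℚ] b j)) :=
      map_sum φ.toLieHom _ _
    have h3 : (g⁻¹).val * g.val = 1 := by rw [← Units.val_mul]; simp
    refine Eq.trans ?_ h1.symm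
    simp only [h2, hφ, Finset.smul_sum, smul_smul]
    rw [Finset.sum_comm]
    simp only [← Finset.sum_smul, ← Matrix.mul_apply, h3]
    simp [Matrix.one_apply]

/-- The polynomial equations, in terms of structure constants, saying that a matrix respects the
Lie bracket. -/
noncomputable def autEquation (b : Module.Basis ι ℚ L) (i j l : ι) : MvPolynomial (ι × ι) ℚ :=
  (∑ p, ∑ q, MvPolynomial.C (b.repr ⁅b p, b q⁆ l) *
      (MvPolynomial.X (i, p) * MvPolynomial.X (j, q))) -
    ∑ r, MvPolynomial.C (b.repr ⁅b i, b j⁆ r) * MvPolynomial.X (r, l)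

theorem mem_autPoints_iff (b : Module.Basis ι ℚ L) (R : Type u) [CommRing R] [Algebra ℚ R]
    (g : GL ι R) :
    g ∈ autPoints b R ↔ ∀ i j l, MvPolynomial.aeval (fun ij : ι × ι => g.val ij.1 ij.2)
      (autEquation b i j l) = 0 := by
  classical
  set B := Algebra.TensorProduct.basis R b with hB
  have hBi : ∀ i, B i = 1 ⊗ₜ b i := fun i => by simp [hB]
  have hbr : ∀ p q, ⁅B p, B q⁆ = ∑ l, algebraMap ℚ R (b.repr ⁅b p, b q⁆ l) • B l := by
    intro p q
    rw [hBi, hBi, LieAlgebra.ExtendScalars.bracket_tmul, mul_one]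
    conv_lhs => rw [← b.sum_repr ⁅b p, b q⁆]
    rw [TensorProduct.tmul_sum]
    refine Finset.sum_congr rfl fun l _ => ?_
    rw [hBi, TensorProduct.tmul_smul, algebraMap_smul]
  have key : ∀ F : (R ⊗[ℚ] L) →ₗ[R] (R ⊗[ℚ] L), (∀ i, F (B i) = ∑ j, g.val i j • B j) →
      ∀ i j, (⁅F (B i), F (B j)⁆ = F ⁅B i, B j⁆ ↔
        ∀ l, MvPolynomial.aeval (fun ij : ι × ι => g.val ij.1 ij.2) (autEquation b i j l) = 0) := by
    intro F hF i j
    have e1 : ⁅F (B i), F (B j)⁆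
        = ∑ l, (∑ p, ∑ q, algebraMap ℚ R (b.repr ⁅b p, b q⁆ l) * (g.val i p * g.val j q)) • B l := by
      rw [hF, hF]
      simp only [sum_lie, lie_sum, smul_lie, lie_smul, hbr, Finset.smul_sum,
        smul_smul, Finset.sum_smul]
      rw [Finset.sum_comm]
      refine (Finset.sum_congr rfl fun p _ => Finset.sum_comm).trans ?_
      refine Finset.sum_comm.trans ?_
      refine Finset.sum_congr rfl fun l _ => ?_
      refine Finset.sum_congr rfl fun p _ => Finset.sum_congr rfl fun q _ => ?_
      congr 1
      ring
    have e2 : F ⁅B i, B j⁆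
        = ∑ l, (∑ r, algebraMap ℚ R (b.repr ⁅b i, b j⁆ r) * g.val r l) • B l := by
      rw [hbr]
      simp only [map_sum, map_smul, hF, Finset.smul_sum, smul_smul, Finset.sum_smul]
      rw [Finset.sum_comm]
    rw [e1, e2]
    simp only [autEquation, map_sub, map_sum, map_mul, MvPolynomial.aeval_X, MvPolynomial.aeval_C,
      sub_eq_zero]
    constructor
    · intro h l
      have := congrArg (fun v => B.repr v l) h
      simpa [Finsupp.single_apply] using this
    · intro h
      exact Finset.sum_congr rfl fun l _ => by rw [h l]
  constructor
  · rintro ⟨φ, hφ⟩ i j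
    refine (key (φ.toLieHom : (R ⊗[ℚ] L) →ₗ[R] (R ⊗[ℚ] L)) ?_ i j).1 ?_
    · intro i
      simp only [hBi]
      exact hφ i
    · exact (LieHom.map_lie φ.toLieHom (B i) (B j)).symm
  · intro h
    let F := Matrix.toLin B B g.valᵀ
    let F' := Matrix.toLin B B (g⁻¹).valᵀ
    have hF : ∀ i, F (B i) = ∑ j, g.val i j • B j := fun i => by
      simp [F, Matrix.toLin_self]
    have h3 : (g⁻¹).val * g.val = 1 := by rw [← Units.val_mul]; simp
    have h4 : g.val * (g⁻¹).val = 1 := by rw [← Units.val_mul]; simp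
    have hlie : ∀ x y, F ⁅x, y⁆ = ⁅F x, F y⁆ := by
      let Q₁ : (R ⊗[ℚ] L) →ₗ[R] (R ⊗[ℚ] L) →ₗ[R] (R ⊗[ℚ] L) :=
        (LieModule.toEnd R (R ⊗[ℚ] L) (R ⊗[ℚ] L) :
          (R ⊗[ℚ] L) →ₗ[R] Module.End R (R ⊗[ℚ] L)).compr₂ F
      let Q₂ : (R ⊗[ℚ] L) →ₗ[R] (R ⊗[ℚ] L) →ₗ[R] (R ⊗[ℚ] L) :=
        (LieModule.toEnd R (R ⊗[ℚ] L) (R ⊗[ℚ] L) :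
          (R ⊗[ℚ] L) →ₗ[R] Module.End R (R ⊗[ℚ] L)).compl₁₂ F F
      have : Q₁ = Q₂ := by
        refine B.ext fun i => B.ext fun j => ?_
        exact ((key F hF i j).2 (h i j)).symm
      intro x y
      exact congrArg (fun Q => Q x y) this
    let E : (R ⊗[ℚ] L) ≃ₗ[R] (R ⊗[ℚ] L) := LinearEquiv.ofLinearMap F F'
      (by rw [← Matrix.toLin_mul, ← Matrix.transpose_mul, h3]; simp)
      (by rw [← Matrix.toLin_mul, ← Matrix.transpose_mul, h4]; simp)
    refine ⟨{ E with map_lie' := fun {x y} => hlie x y }, fun i => ?_⟩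
    have := hF i
    simp only [hBi] at this
    exact this

/-- The algebraic automorphism group of a Lie algebra over `ℚ`, realised with respect to the basis
`b`. -/
def algebraicAutGroup (b : Module.Basis ι ℚ L) : AlgSubgroup.{u} ι where
  pts R _ _ := autPoints b R
  exists_equations := ⟨{p | ∃ i j l, p = autEquation b i j l}, fun R _ _ g => by
    rw [mem_autPoints_iff]
    constructor
    · rintro h p ⟨i, j, l, rfl⟩
      exact h i j l
    · exact fun h i j l => h _ ⟨i, j, l, rfl⟩⟩

end Aut

end AlgebraicGroups

/-! ### The Lie algebra attached to a monic polynomial -/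

/-- The companion matrix with ones above the diagonal and last row
`(a_m, a_{m-1}, …, a_1)`, where `f = x^m - a_1 x^{m-1} - ⋯ - a_m`. -/
noncomputable def companionMatrix (m : ℕ) (f : Polynomial ℚ) : Matrix (Fin m) (Fin m) ℚ :=
  Matrix.of fun i j =>
    if (i : ℕ) + 1 = j then 1 else if (i : ℕ) + 1 = m then -f.coeff j else 0

/-- The antisymmetric matrix with off-diagonal blocks `U` and `-Uᵗ`. -/
def formMatrix {m : ℕ} (U : Matrix (Fin m) (Fin m) ℚ) : Matrix (Fin m ⊕ Fin m) (Fin m ⊕ Fin m) ℚ :=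
  Matrix.fromBlocks 0 U (-Uᵀ) 0

/-- The underlying vector space of the `D*`-Lie algebra of the monic polynomial `f` of degree `m`,
with coordinates in the ordered basis `(x_1, …, x_m, y_1, …, y_m, e, f)`. -/
def DStarLieAlgebra (m : ℕ) (_f : Polynomial ℚ) : Type := (Fin m ⊕ Fin m) ⊕ Fin 2 → ℚ

namespace DStarLieAlgebra

variable {m : ℕ} {f : Polynomial ℚ}

instance : AddCommGroup (DStarLieAlgebra m f) :=
  inferInstanceAs (AddCommGroup ((Fin m ⊕ Fin m) ⊕ Fin 2 → ℚ))

instance : Module ℚ (DStarLieAlgebra m f) :=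
  inferInstanceAs (Module ℚ ((Fin m ⊕ Fin m) ⊕ Fin 2 → ℚ))

/-- The `x`- and `y`-coordinates of a vector. -/
def top (u : DStarLieAlgebra m f) : Fin m ⊕ Fin m → ℚ := fun i => u (Sum.inl i)

/-- The bracket `[u, v] = (u J_I vᵗ) e + (u J_K vᵗ) f`, with `K` the companion matrix. -/
noncomputable instance : Bracket (DStarLieAlgebra m f) (DStarLieAlgebra m f) where
  bracket u v := Sum.elim 0
    ![top u ⬝ᵥ (formMatrix 1 *ᵥ top v), top u ⬝ᵥ (formMatrix (companionMatrix m f) *ᵥ top v)]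

theorem bracket_def (u v : DStarLieAlgebra m f) : ⁅u, v⁆ = (Sum.elim 0
    ![top u ⬝ᵥ (formMatrix 1 *ᵥ top v), top u ⬝ᵥ (formMatrix (companionMatrix m f) *ᵥ top v)] :
      (Fin m ⊕ Fin m) ⊕ Fin 2 → ℚ) := rfl

theorem top_add (u v : DStarLieAlgebra m f) : top (u + v) = top u + top v := rfl

theorem top_smul (t : ℚ) (u : DStarLieAlgebra m f) : top (t • u) = t • top u := rfl

theorem top_bracket (u v : DStarLieAlgebra m f) : top ⁅u, v⁆ = 0 := rfl

theorem form_self (U : Matrix (Fin m) (Fin m) ℚ) (a : Fin m ⊕ Fin m → ℚ) :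
    a ⬝ᵥ (formMatrix U *ᵥ a) = 0 := by
  have h : a ⬝ᵥ (formMatrix U *ᵥ a) = -(a ⬝ᵥ (formMatrix U *ᵥ a)) := by
    conv_lhs => rw [Matrix.dotProduct_mulVec, ← Matrix.mulVec_transpose, dotProduct_comm]
    have : (formMatrix U)ᵀ = -formMatrix U := by
      simp [formMatrix, Matrix.fromBlocks_transpose, Matrix.fromBlocks_neg]
    rw [this, Matrix.neg_mulVec, dotProduct_neg]
  linarith

noncomputable instance : LieRing (DStarLieAlgebra m f) where
  add_lie u v w := by
    funext i
    change ⁅u + v, w⁆ i = ⁅u, w⁆ i + ⁅v, w⁆ i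
    simp only [bracket_def, top_add]
    rcases i with i | i
    · simp
    · fin_cases i <;> simp [add_dotProduct]
  lie_add u v w := by
    funext i
    change ⁅u, v + w⁆ i = ⁅u, v⁆ i + ⁅u, w⁆ i
    simp only [bracket_def, top_add]
    rcases i with i | i
    · simp
    · fin_cases i <;> simp [dotProduct_add, Matrix.mulVec_add]
  lie_self u := by
    funext i
    change ⁅u, u⁆ i = 0
    simp only [bracket_def, form_self]
    rcases i with i | i
    · simp
    · fin_cases i <;> simp
  leibniz_lie u v w := by
    funext i
    change ⁅u, ⁅v, w⁆⁆ i = ⁅⁅u, v⁆, w⁆ i + ⁅v, ⁅u, w⁆⁆ i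
    rw [bracket_def u, bracket_def ⁅u, v⁆, bracket_def v ⁅u, w⁆]
    simp only [top_bracket]
    rcases i with i | i
    · simp
    · fin_cases i <;> simp

noncomputable instance : LieAlgebra ℚ (DStarLieAlgebra m f) where
  lie_smul t u v := by
    funext i
    change ⁅u, t • v⁆ i = t * ⁅u, v⁆ i
    simp only [bracket_def, top_smul]
    rcases i with i | i
    · simp
    · fin_cases i <;> simp [Matrix.mulVec_smul]

/-- The basis `(x_1, …, x_m, y_1, …, y_m, e, f)`. -/
noncomputable def basisS (m : ℕ) (f : Polynomial ℚ) :
    Module.Basis ((Fin m ⊕ Fin m) ⊕ Fin 2) ℚ (DStarLieAlgebra m f) :=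
  Pi.basisFun ℚ ((Fin m ⊕ Fin m) ⊕ Fin 2)

theorem basisS_apply (i k : (Fin m ⊕ Fin m) ⊕ Fin 2) :
    basisS m f i k = if k = i then 1 else 0 := by
  have : basisS m f i k = (Pi.single i (1 : ℚ) : (Fin m ⊕ Fin m) ⊕ Fin 2 → ℚ) k := by
    simp only [← Pi.basisFun_apply]
    rfl
  rw [this, Pi.single_apply]

noncomputable def x (m : ℕ) (f : Polynomial ℚ) (i : Fin m) : DStarLieAlgebra m f :=
  basisS m f (Sum.inl (Sum.inl i))

noncomputable def y (m : ℕ) (f : Polynomial ℚ) (i : Fin m) : DStarLieAlgebra m f :=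
  basisS m f (Sum.inl (Sum.inr i))

/-- The central basis vector `e`. -/
noncomputable def ce (m : ℕ) (f : Polynomial ℚ) : DStarLieAlgebra m f := basisS m f (Sum.inr 0)

/-- The central basis vector `f`. -/
noncomputable def cf (m : ℕ) (f : Polynomial ℚ) : DStarLieAlgebra m f := basisS m f (Sum.inr 1)

/-- The position in `(x_1, …, x_m, y_1, …, y_m, e, f)` of the members of the ordered basis
`(x_1, y_m, x_2, y_{m-1}, …, x_m, y_1, f, e)`. The latter is indexed by `m + 1` consecutive pairs:
the pair `i < m` is `(x_{i+1}, y_{m-i})` and the last one is `(f, e)`. -/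
def basisPosition (m : ℕ) : (Fin m × Fin 2) ⊕ Fin 2 ≃ (Fin m ⊕ Fin m) ⊕ Fin 2 where
  toFun := Sum.elim
    (fun p => if p.2 = 0 then Sum.inl (Sum.inl p.1) else Sum.inl (Sum.inr p.1.rev))
    (fun a => Sum.inr a.rev)
  invFun := Sum.elim
    (Sum.elim (fun i => Sum.inl (i, 0)) (fun i => Sum.inl (i.rev, 1)))
    (fun a => Sum.inr a.rev)
  left_inv := by
    rintro (⟨i, a⟩ | a)
    · fin_cases a <;> simp
    · simp
  right_inv := by
    rintro ((i | i) | a) <;> simp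

/-- The ordered basis `(x_1, y_m, x_2, y_{m-1}, …, x_m, y_1, f, e)`. -/
noncomputable def basisC (m : ℕ) (f : Polynomial ℚ) :
    Module.Basis ((Fin m × Fin 2) ⊕ Fin 2) ℚ (DStarLieAlgebra m f) :=
  (basisS m f).reindex (basisPosition m).symm

theorem basisC_x (i : Fin m) : basisC m f (Sum.inl (i, 0)) = x m f i := by
  simp [basisC, basisPosition, x]

theorem basisC_y (i : Fin m) : basisC m f (Sum.inl (i, 1)) = y m f i.rev := by
  simp [basisC, basisPosition, y]

theorem basisC_f : basisC m f (Sum.inr 0) = cf m f := by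
  simp [basisC, basisPosition, cf]

theorem basisC_e : basisC m f (Sum.inr 1) = ce m f := by
  simp [basisC, basisPosition, ce]

theorem lie_x_y (i j : Fin m) : ⁅x m f i, y m f j⁆ =
    (if i = j then (1 : ℚ) else 0) • ce m f + companionMatrix m f i j • cf m f := by
  funext k
  change _ = (if i = j then (1 : ℚ) else 0) * ce m f k + companionMatrix m f i j * cf m f k
  have hx : top (x m f i) = Pi.single (Sum.inl i) 1 := by
    funext k; simp [top, x, basisS_apply, Pi.single_apply]
  have hy : top (y m f j) = Pi.single (Sum.inr j) 1 := by
    funext k; simp [top, y, basisS_apply, Pi.single_apply]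
  rw [bracket_def, hx, hy]
  rcases k with k | k
  · simp [ce, cf, basisS_apply]
  · fin_cases k <;> simp [ce, cf, basisS_apply, formMatrix, Matrix.one_apply]

theorem lie_x_x (i j : Fin m) : ⁅x m f i, x m f j⁆ = 0 := by
  funext k
  change _ = (0 : ℚ)
  have hx : ∀ i, top (x m f i) = Pi.single (Sum.inl i) 1 := by
    intro i; funext k; simp [top, x, basisS_apply, Pi.single_apply]
  rw [bracket_def, hx, hx]
  rcases k with k | k
  · simp
  · fin_cases k <;> simp [formMatrix]

theorem lie_y_y (i j : Fin m) : ⁅y m f i, y m f j⁆ = 0 := by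
  funext k
  change _ = (0 : ℚ)
  have hy : ∀ i, top (y m f i) = Pi.single (Sum.inr i) 1 := by
    intro i; funext k; simp [top, y, basisS_apply, Pi.single_apply]
  rw [bracket_def, hy, hy]
  rcases k with k | k
  · simp
  · fin_cases k <;> simp [formMatrix]

end DStarLieAlgebra

/-! ### The explicit matrices -/

/-- The block diagonal matrix
`diag(μ^{m-1} A, μ^{m-2} A, …, μ A, A, μ^m det A, μ^{m-1} det A)`. -/
def reductiveMatrix (m : ℕ) {R : Type u} [CommRing R] (A : Matrix (Fin 2) (Fin 2) R) (μ : R) :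
    Matrix ((Fin m × Fin 2) ⊕ Fin 2) ((Fin m × Fin 2) ⊕ Fin 2) R :=
  Matrix.fromBlocks (Matrix.diagonal (fun i : Fin m => μ ^ (m - 1 - (i : ℕ))) ⊗ₖ A) 0
    0 (Matrix.diagonal ![μ ^ m * A.det, μ ^ (m - 1) * A.det])

/-- The space `𝔫₀(k)`: the upper left part is block Toeplitz and strictly block upper triangular with
trace zero `2 × 2` blocks (`X d` stands on the `d`-th block superdiagonal), the upper right part `Z`
is arbitrary, and the last two rows vanish. -/
def nilpotentSet (m : ℕ) (k : Type u) [Field k] :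
    Set (Matrix ((Fin m × Fin 2) ⊕ Fin 2) ((Fin m × Fin 2) ⊕ Fin 2) k) :=
  {M | ∃ (X : ℕ → Matrix (Fin 2) (Fin 2) k) (Z : Matrix (Fin m × Fin 2) (Fin 2) k),
    (∀ d, (X d).trace = 0) ∧
    M = Matrix.fromBlocks
      (Matrix.of fun p q => if p.1 < q.1 then X ((q.1 : ℕ) - (p.1 : ℕ)) p.2 q.2 else 0) Z 0 0}

/-- The matrix `ξ₃`: the scalar `2 × 2` blocks `(3 - m)/2, (5 - m)/2, …, (m - 1)/2` on the first block
superdiagonal of the upper left part, and a single `1` in the lower right part. -/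
def xiThree (m : ℕ) : Matrix ((Fin m × Fin 2) ⊕ Fin 2) ((Fin m × Fin 2) ⊕ Fin 2) ℚ :=
  Matrix.fromBlocks
    (Matrix.of fun p q =>
      if (p.1 : ℕ) + 1 = q.1 ∧ p.2 = q.2 then (2 * ((p.1 : ℕ) : ℚ) + 3 - m) / 2 else 0)
    0 0 !![0, 1; 0, 0]

/-- The elements `exp(X)`, `X ∈ 𝔫₀(k)`, and `exp(t ξ₃)`, `t ∈ k`, of the general linear group (the
exponential series is finite, as these matrices are nilpotent). -/
def unipotentGenerators (m : ℕ) (k : Type u) [Field k] [Algebra ℚ k] :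
    Set (GL ((Fin m × Fin 2) ⊕ Fin 2) k) :=
  {g | ∃ X ∈ nilpotentSet m k, g.val = IsNilpotent.exp X} ∪
  {g | ∃ t : k, g.val = IsNilpotent.exp (t • (xiThree m).map (algebraMap ℚ k))}

/-! The bracket consists of two alternating forms on the span of the x's and y's, with Gram matrices
P_f and P_e. In the ordered basis by pairs, P_e is invertible and P_f = J P_e, where J is the
nilpotent shift of the pairs. An automorphism is a block matrix with rows (T, Z) and (0, B), where Z
is arbitrary and B records how T transforms the pencil: T P_f Tᵗ = d P_f + b P_e and T P_e Tᵗ = c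
P_f + a P_e.

Since det(x P_e + y P_f) = x^(2m) det P_e, comparing determinants makes a a unit and forces b = 0
(`coefficient_eq_zero`). Eliminating Tᵗ leaves the linear relation a T J + c J T J = d J T
(`shift_relation`). Read entrywise, it says that T is block upper triangular and that its diagonal
blocks form a geometric progression of ratio μ = d/a ending in a block A; one further entry gives a
= μ^(m-1) det A. Thus every automorphism is, up to terms raising the degree, one of the block
diagonal matrices of H (`exists_reductiveHom_sub_strict`). This holds over every ℚ-algebra and
yields the semidirect product, with N the automorphisms trivial on the graded space.

The automorphism group is itself connected, being covered by polynomial curves through 1: a torus in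
H contracts N to 1, and a segment joins an element of H to 1. N is the radical because a unipotent
subgroup normalised by H has trivial image in H: unipotence of both A and (P A P⁻¹) A for two
elementary matrices P forces A = 1 (`le_unipotentPoints`). The same lemma shows that H is reductive.

The stated generators are exponentials of nilpotent derivations, hence lie in N. Conversely, given
an element of N, a factor exp(t ξ₃) removes its action on the centre; then T commutes with J, so it
is block Toeplitz. Its first nonzero superdiagonal block is traceless and can be cancelled by
exponentials; after all superdiagonals are cleared only Z remains, and it is itself an exponential
(`unipotentPoints_eq_closure`). -/

/-! ### Structure constants -/

/-- The `2 × 2` block `(i, j)` of the form matrices of the components `f` (for `a = 0`) and `e`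
(for `a = 1`) of the Lie bracket: a symplectic block on one antidiagonal. -/
def antidiagonalMatrix (m : ℕ) (R : Type u) [CommRing R] (a : Fin 2) : Matrix (Fin m) (Fin m) R :=
  Matrix.of fun i j => if (i : ℕ) + j + 2 = m + a then 1 else 0

/-- The standard `2 × 2` symplectic matrix. -/
def symplecticBlock (R : Type u) [CommRing R] : Matrix (Fin 2) (Fin 2) R := !![0, 1; -1, 0]

/-- The Gram matrices of the components `f` (for `a = 0`) and `e` (for `a = 1`) of the bracket. -/
def gramMatrix (m : ℕ) (R : Type u) [CommRing R] (a : Fin 2) :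
    Matrix (Fin m × Fin 2) (Fin m × Fin 2) R :=
  antidiagonalMatrix m R a ⊗ₖ symplecticBlock R

theorem gramMatrix_apply (m : ℕ) (R : Type u) [CommRing R] (a : Fin 2) (p q : Fin m × Fin 2) :
    gramMatrix m R a p q =
      if (p.1 : ℕ) + q.1 + 2 = m + a then symplecticBlock R p.2 q.2 else 0 := by
  simp [gramMatrix, antidiagonalMatrix, Matrix.kroneckerMap_apply]

theorem basisC_repr (m : ℕ) (f : Polynomial ℚ) (v : DStarLieAlgebra m f)
    (l : (Fin m × Fin 2) ⊕ Fin 2) :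
    (DStarLieAlgebra.basisC m f).repr v l = v (DStarLieAlgebra.basisPosition m l) := by
  rw [DStarLieAlgebra.basisC, Module.Basis.repr_reindex_apply]
  rfl

theorem top_basisC_inl (m : ℕ) (f : Polynomial ℚ) (p : Fin m × Fin 2) :
    DStarLieAlgebra.top (DStarLieAlgebra.basisC m f (Sum.inl p)) =
      Pi.single (if p.2 = 0 then Sum.inl p.1 else Sum.inr p.1.rev) 1 := by
  funext k
  obtain ⟨i, a⟩ := p
  fin_cases a
  · simp [DStarLieAlgebra.basisC_x, DStarLieAlgebra.top, DStarLieAlgebra.x,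
      DStarLieAlgebra.basisS_apply, Pi.single_apply]
  · simp [DStarLieAlgebra.basisC_y, DStarLieAlgebra.top, DStarLieAlgebra.y,
      DStarLieAlgebra.basisS_apply, Pi.single_apply]

theorem top_basisC_inr (m : ℕ) (f : Polynomial ℚ) (a : Fin 2) :
    DStarLieAlgebra.top (DStarLieAlgebra.basisC m f (Sum.inr a)) = 0 := by
  funext k
  fin_cases a
  · simp [DStarLieAlgebra.basisC_f, DStarLieAlgebra.top, DStarLieAlgebra.cf,
      DStarLieAlgebra.basisS_apply]
  · simp [DStarLieAlgebra.basisC_e, DStarLieAlgebra.top, DStarLieAlgebra.ce,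
      DStarLieAlgebra.basisS_apply]

theorem companionMatrix_X_pow (m : ℕ) (i j : Fin m) :
    companionMatrix m (Polynomial.X ^ m) i j = if (i : ℕ) + 1 = j then 1 else 0 := by
  have : (j : ℕ) ≠ m := j.2.ne
  simp [companionMatrix, Polynomial.coeff_X_pow, this]

theorem formMatrix_one_apply (m : ℕ) (p q : Fin m × Fin 2) :
    formMatrix (1 : Matrix (Fin m) (Fin m) ℚ)
      (if p.2 = 0 then Sum.inl p.1 else Sum.inr p.1.rev)
      (if q.2 = 0 then Sum.inl q.1 else Sum.inr q.1.rev) = gramMatrix m ℚ 1 p q := by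
  obtain ⟨i, a⟩ := p
  obtain ⟨j, b⟩ := q
  fin_cases a <;> fin_cases b <;>
    simp [formMatrix, gramMatrix_apply, symplecticBlock, Matrix.one_apply, Fin.ext_iff,
      Fin.val_rev]
  · congr 1
    apply propext; omega
  · split_ifs <;> first | rfl | omega

theorem formMatrix_companion_apply (m : ℕ) (p q : Fin m × Fin 2) :
    formMatrix (companionMatrix m (Polynomial.X ^ m))
      (if p.2 = 0 then Sum.inl p.1 else Sum.inr p.1.rev)
      (if q.2 = 0 then Sum.inl q.1 else Sum.inr q.1.rev) = gramMatrix m ℚ 0 p q := by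
  obtain ⟨i, a⟩ := p
  obtain ⟨j, b⟩ := q
  fin_cases a <;> fin_cases b <;>
    simp [formMatrix, gramMatrix_apply, symplecticBlock, companionMatrix_X_pow,
      Fin.val_rev]
  · congr 1
    apply propext; omega
  · split_ifs <;> first | rfl | omega

/-- The Gram matrices, extended by zero to the centre. -/
def bracketMatrix (m : ℕ) (R : Type u) [CommRing R] (l : (Fin m × Fin 2) ⊕ Fin 2) :
    Matrix ((Fin m × Fin 2) ⊕ Fin 2) ((Fin m × Fin 2) ⊕ Fin 2) R :=
  Sum.elim 0 (fun a => Matrix.fromBlocks (gramMatrix m R a) 0 0 0) l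

theorem map_gramMatrix (m : ℕ) (R : Type u) [CommRing R] [Algebra ℚ R] (a : Fin 2)
    (p q : Fin m × Fin 2) : algebraMap ℚ R (gramMatrix m ℚ a p q) = gramMatrix m R a p q := by
  obtain ⟨i, c⟩ := p
  obtain ⟨j, d⟩ := q
  rw [gramMatrix_apply, gramMatrix_apply]
  split_ifs <;> fin_cases c <;> fin_cases d <;> simp [symplecticBlock]

theorem structureConstant (m : ℕ) (R : Type u) [CommRing R] [Algebra ℚ R]
    (p q l : (Fin m × Fin 2) ⊕ Fin 2) :
    algebraMap ℚ R ((DStarLieAlgebra.basisC m (Polynomial.X ^ m)).repr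
      ⁅DStarLieAlgebra.basisC m (Polynomial.X ^ m) p,
        DStarLieAlgebra.basisC m (Polynomial.X ^ m) q⁆ l) = bracketMatrix m R l p q := by
  rw [basisC_repr, DStarLieAlgebra.bracket_def]
  rcases l with ⟨i, a⟩ | a
  · fin_cases a <;> simp [bracketMatrix, DStarLieAlgebra.basisPosition]
  · rcases p with p | p
    · rcases q with q | q
      · fin_cases a
        · simp [bracketMatrix, DStarLieAlgebra.basisPosition, top_basisC_inl,
            formMatrix_companion_apply, map_gramMatrix]
        · simp [bracketMatrix, DStarLieAlgebra.basisPosition, top_basisC_inl,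
            formMatrix_one_apply, map_gramMatrix]
      · fin_cases a <;>
        simp [bracketMatrix, DStarLieAlgebra.basisPosition, top_basisC_inr]
    · rcases q with q | q <;> fin_cases a <;>
        simp [bracketMatrix, DStarLieAlgebra.basisPosition, top_basisC_inr]

/-- The points of the automorphism group. -/
noncomputable abbrev autGroup (m : ℕ) (R : Type u) [CommRing R] [Algebra ℚ R] :
    Subgroup (GL ((Fin m × Fin 2) ⊕ Fin 2) R) :=
  autPoints (DStarLieAlgebra.basisC m (Polynomial.X ^ m)) R

theorem mem_autGroup_iff_bracketMatrix (m : ℕ) (R : Type u) [CommRing R] [Algebra ℚ R]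
    (g : GL ((Fin m × Fin 2) ⊕ Fin 2) R) :
    g ∈ autGroup m R ↔
      ∀ l, g.val * bracketMatrix m R l * g.valᵀ = ∑ r, g.val r l • bracketMatrix m R r := by
  have key : ∀ i j l, MvPolynomial.aeval (fun ij : _ × _ => g.val ij.1 ij.2)
      (autEquation (DStarLieAlgebra.basisC m (Polynomial.X ^ m)) i j l) =
      (g.val * bracketMatrix m R l * g.valᵀ) i j - (∑ r, g.val r l • bracketMatrix m R r) i j := by
    intro i j l
    rw [autEquation]
    simp only [map_sub, map_sum, map_mul, MvPolynomial.aeval_X, MvPolynomial.aeval_C,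
      structureConstant, Matrix.sum_apply, Matrix.smul_apply, smul_eq_mul]
    congr 1
    · rw [Matrix.mul_apply]
      simp only [Matrix.mul_apply, Matrix.transpose_apply, Finset.sum_mul]
      rw [Finset.sum_comm]
      exact Finset.sum_congr rfl fun p _ => Finset.sum_congr rfl fun q _ => by ring
    · exact Finset.sum_congr rfl fun p _ => by ring
  rw [autGroup, mem_autPoints_iff]
  simp only [key, sub_eq_zero]
  constructor
  · exact fun h l => Matrix.ext fun i j => h i j l
  · exact fun h i j l => by rw [h l]

/-- The Lie bracket as a matrix from the tensor square to the Lie algebra. -/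
def bracketTensor (m : ℕ) (R : Type u) [CommRing R] :
    Matrix (((Fin m × Fin 2) ⊕ Fin 2) × ((Fin m × Fin 2) ⊕ Fin 2)) ((Fin m × Fin 2) ⊕ Fin 2) R :=
  Matrix.of fun pq l => bracketMatrix m R l pq.1 pq.2

theorem kronecker_mul_bracketTensor_apply (m : ℕ) (R : Type u) [CommRing R]
    (g h : Matrix ((Fin m × Fin 2) ⊕ Fin 2) ((Fin m × Fin 2) ⊕ Fin 2) R)
    (i j l : (Fin m × Fin 2) ⊕ Fin 2) :
    ((g ⊗ₖ h) * bracketTensor m R) (i, j) l = (g * bracketMatrix m R l * hᵀ) i j := by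
  rw [Matrix.mul_apply, Fintype.sum_prod_type, Matrix.mul_apply]
  simp only [bracketTensor, Matrix.mul_apply, Matrix.kroneckerMap_apply, Matrix.of_apply,
    Matrix.transpose_apply, Finset.sum_mul]
  rw [Finset.sum_comm]
  exact Finset.sum_congr rfl fun p _ => Finset.sum_congr rfl fun q _ => by ring

theorem bracketTensor_mul_apply (m : ℕ) (R : Type u) [CommRing R]
    (g : Matrix ((Fin m × Fin 2) ⊕ Fin 2) ((Fin m × Fin 2) ⊕ Fin 2) R)
    (i j l : (Fin m × Fin 2) ⊕ Fin 2) :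
    (bracketTensor m R * g) (i, j) l = (∑ r, g r l • bracketMatrix m R r) i j := by
  rw [Matrix.mul_apply]
  simp only [bracketTensor, Matrix.of_apply, Matrix.sum_apply, Matrix.smul_apply, smul_eq_mul]
  exact Finset.sum_congr rfl fun p _ => by ring

/-- As an intertwining relation, linear in the pair (g ⊗ g, g), the condition passes from a
derivation to its exponential. -/
theorem mem_autGroup_iff_kronecker (m : ℕ) (R : Type u) [CommRing R] [Algebra ℚ R]
    (g : GL ((Fin m × Fin 2) ⊕ Fin 2) R) :
    g ∈ autGroup m R ↔
      (g.val ⊗ₖ g.val) * bracketTensor m R = bracketTensor m R * g.val := by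
  rw [mem_autGroup_iff_bracketMatrix]
  constructor
  · intro h
    ext ⟨i, j⟩ l
    rw [kronecker_mul_bracketTensor_apply, bracketTensor_mul_apply, h]
  · intro h l
    ext i j
    rw [← kronecker_mul_bracketTensor_apply, ← bracketTensor_mul_apply, h]

theorem symplecticBlock_mul_self (R : Type u) [CommRing R] :
    symplecticBlock R * symplecticBlock R = -1 := by
  ext i j
  fin_cases i <;> fin_cases j <;> simp [symplecticBlock]

theorem antidiagonalMatrix_one_mul_apply (m : ℕ) (R : Type u) [CommRing R]
    (M : Matrix (Fin m) (Fin m) R) (i j : Fin m) :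
    (antidiagonalMatrix m R 1 * M) i j = M i.rev j := by
  rw [Matrix.mul_apply, Finset.sum_eq_single i.rev]
  · have : (i : ℕ) + (i.rev : ℕ) + 2 = m + 1 := by rw [Fin.val_rev]; omega
    simp only [antidiagonalMatrix, Matrix.of_apply, Fin.val_one, this, if_true, one_mul]
  · intro k _ hk
    have : ¬ ((i : ℕ) + (k : ℕ) + 2 = m + 1) := fun h => hk (Fin.ext (by rw [Fin.val_rev]; omega))
    simp only [antidiagonalMatrix, Matrix.of_apply, Fin.val_one, this, if_false, zero_mul]
  · simp

theorem gramMatrix_one_mul_self (m : ℕ) (R : Type u) [CommRing R] :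
    gramMatrix m R 1 * gramMatrix m R 1 = -1 := by
  rw [gramMatrix, ← Matrix.mul_kronecker_mul, symplecticBlock_mul_self]
  have : antidiagonalMatrix m R 1 * antidiagonalMatrix m R 1 = 1 := by
    ext i j
    rw [antidiagonalMatrix_one_mul_apply]
    simp only [antidiagonalMatrix, Matrix.of_apply, Matrix.one_apply, Fin.val_one, Fin.val_rev,
      Fin.ext_iff]
    congr 1
    apply propext; omega
  rw [this]
  ext ⟨i, a⟩ ⟨j, b⟩
  simp only [Matrix.kroneckerMap_apply, Matrix.neg_apply, Matrix.one_apply, Prod.ext_iff]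
  split_ifs <;> simp_all

/-- The form of e is nondegenerate on the span of the x's and y's, so the centre is exactly the span
of e and f and is preserved. Nothing constrains the upper right block. -/
theorem mem_autGroup_iff (m : ℕ) (R : Type u) [CommRing R] [Algebra ℚ R]
    (g : GL ((Fin m × Fin 2) ⊕ Fin 2) R) :
    g ∈ autGroup m R ↔ g.val.toBlocks₂₁ = 0 ∧
      ∀ a, g.val.toBlocks₁₁ * gramMatrix m R a * g.val.toBlocks₁₁ᵀ =
        g.val.toBlocks₂₂ 0 a • gramMatrix m R 0 + g.val.toBlocks₂₂ 1 a • gramMatrix m R 1 := by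
  rw [mem_autGroup_iff_bracketMatrix]
  have hsum : ∀ l, ∑ r, g.val r l • bracketMatrix m R r =
      Matrix.fromBlocks (g.val (Sum.inr 0) l • gramMatrix m R 0 +
        g.val (Sum.inr 1) l • gramMatrix m R 1) 0 0 0 := by
    intro l
    simp [bracketMatrix, Fintype.sum_sum_type, Matrix.fromBlocks_smul, Matrix.fromBlocks_add]
  simp only [hsum]
  obtain ⟨T, Z, C, B, hg⟩ : ∃ T Z C B, g.val = Matrix.fromBlocks T Z C B :=
    ⟨_, _, _, _, (Matrix.fromBlocks_toBlocks g.val).symm⟩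
  have hmul : ∀ a, g.val * bracketMatrix m R (Sum.inr a) * g.valᵀ =
      Matrix.fromBlocks (T * gramMatrix m R a * Tᵀ) (T * gramMatrix m R a * Cᵀ)
        (C * gramMatrix m R a * Tᵀ) (C * gramMatrix m R a * Cᵀ) := by
    intro a
    simp [hg, bracketMatrix, Matrix.fromBlocks_transpose, Matrix.fromBlocks_multiply]
  constructor
  · intro h
    have hC : C = 0 := by
      have h1 := h (Sum.inr 1)
      -- Cancelling g on the left exposes the upper right block P_e Cᵗ on one side and zero on the
      -- other; P_e is invertible.
      have h2 : bracketMatrix m R (Sum.inr 1) * g.valᵀ = (g⁻¹).val *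
          Matrix.fromBlocks (g.val (Sum.inr 0) (Sum.inr 1) • gramMatrix m R 0 +
            g.val (Sum.inr 1) (Sum.inr 1) • gramMatrix m R 1) 0 0 0 := by
        rw [← h1, ← mul_assoc, ← mul_assoc, ← Units.val_mul]; simp
      rw [← Matrix.fromBlocks_toBlocks (g⁻¹).val, hg] at h2
      simp only [bracketMatrix, Sum.elim_inr, Matrix.fromBlocks_transpose,
        Matrix.fromBlocks_multiply, Matrix.fromBlocks_inj] at h2
      have h3 : gramMatrix m R 1 * Cᵀ = 0 := by simpa using h2.2.1
      have h4 : Cᵀ = 0 := by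
        have := congrArg (gramMatrix m R 1 * ·) h3
        simpa [← mul_assoc, ← Matrix.mul_assoc, gramMatrix_one_mul_self] using this
      simpa using congrArg Matrix.transpose h4
    refine ⟨by simp [hg, hC], fun a => ?_⟩
    have h1 := h (Sum.inr a)
    rw [hmul, Matrix.fromBlocks_inj] at h1
    simpa [hg] using h1.1
  · rintro ⟨hC, h⟩
    have hC' : C = 0 := by simpa [hg] using hC
    rintro (l | a)
    · simp [hg, hC', bracketMatrix]
    · rw [hmul]
      have := h a
      simp only [hg, Matrix.toBlocks_fromBlocks₁₁, Matrix.toBlocks_fromBlocks₂₂] at this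
      simp [hC', hg, this]

/-! ### Matrices and a grading of the index set -/

/-- The degrees of the basis vectors: the pair `(x_{i+1}, y_{m-i})` has degree `i`, and `f`, `e` have
degrees `m`, `m + 1`. -/
def basisDegree (m : ℕ) : (Fin m × Fin 2) ⊕ Fin 2 → ℕ :=
  Sum.elim (fun p => p.1) (fun a => m + a)

/-- All entries that do not raise the degree vanish. -/
def IsStrictlyTriangular {ι : Type*} {R : Type*} [Zero R] (w : ι → ℕ) (M : Matrix ι ι R) : Prop :=
  ∀ p q, w q ≤ w p → M p q = 0

/-- All entries that do not preserve the degree vanish. -/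
def IsHomogeneous {ι : Type*} {R : Type*} [Zero R] (w : ι → ℕ) (M : Matrix ι ι R) : Prop :=
  ∀ p q, w p ≠ w q → M p q = 0

section Triangular

variable {ι : Type*} {R : Type*} [CommRing R] {w : ι → ℕ} {M M' : Matrix ι ι R}

theorem IsStrictlyTriangular.blockTriangular (h : IsStrictlyTriangular w M) :
    M.BlockTriangular w := fun p q hpq => h p q hpq.le

theorem IsHomogeneous.blockTriangular (h : IsHomogeneous w M) : M.BlockTriangular w :=
  fun p q hpq => h p q hpq.ne'

theorem IsStrictlyTriangular.add (h : IsStrictlyTriangular w M) (h' : IsStrictlyTriangular w M') :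
    IsStrictlyTriangular w (M + M') := fun p q hpq => by simp [h p q hpq, h' p q hpq]

theorem IsStrictlyTriangular.neg (h : IsStrictlyTriangular w M) : IsStrictlyTriangular w (-M) :=
  fun p q hpq => by simp [h p q hpq]

theorem IsHomogeneous.sub (h : IsHomogeneous w M) (h' : IsHomogeneous w M') :
    IsHomogeneous w (M - M') := fun p q hpq => by simp [h p q hpq, h' p q hpq]

/-- Uniqueness of the degree-preserving part: it is used to pass from congruence modulo strictly
triangular matrices to equality. -/
theorem IsHomogeneous.eq_zero (h : IsHomogeneous w M) (h' : IsStrictlyTriangular w M) : M = 0 := by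
  ext p q
  by_cases hpq : w p = w q
  · exact h' p q hpq.ge
  · exact h p q hpq

theorem isHomogeneous_one [DecidableEq ι] : IsHomogeneous w (1 : Matrix ι ι R) :=
  fun _ _ hpq => Matrix.one_apply_ne fun h => hpq (congrArg w h)

variable [Fintype ι]

theorem IsStrictlyTriangular.mul_left (h : IsStrictlyTriangular w M)
    (h' : M'.BlockTriangular w) : IsStrictlyTriangular w (M' * M) := by
  intro p q hpq
  rw [Matrix.mul_apply]
  refine Finset.sum_eq_zero fun r _ => ?_
  rcases lt_or_ge (w r) (w p) with hr | hr
  · rw [h' hr, zero_mul]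
  · rw [h r q (hpq.trans hr), mul_zero]

theorem IsStrictlyTriangular.mul_right (h : IsStrictlyTriangular w M)
    (h' : M'.BlockTriangular w) : IsStrictlyTriangular w (M * M') := by
  intro p q hpq
  rw [Matrix.mul_apply]
  refine Finset.sum_eq_zero fun r _ => ?_
  rcases lt_or_ge (w q) (w r) with hr | hr
  · rw [h' hr, mul_zero]
  · rw [h p r (hr.trans hpq), zero_mul]

theorem IsHomogeneous.mul (h : IsHomogeneous w M) (h' : IsHomogeneous w M') :
    IsHomogeneous w (M * M') := by
  intro p q hpq
  rw [Matrix.mul_apply]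
  refine Finset.sum_eq_zero fun r _ => ?_
  by_cases hr : w p = w r
  · rw [h' r q (hr ▸ hpq), mul_zero]
  · rw [h p r hr, zero_mul]

variable [DecidableEq ι]

theorem IsHomogeneous.pow (h : IsHomogeneous w M) (n : ℕ) : IsHomogeneous w (M ^ n) := by
  induction n with
  | zero => rw [pow_zero]; exact isHomogeneous_one
  | succ n ih => rw [pow_succ]; exact ih.mul h

theorem IsStrictlyTriangular.pow (h : IsStrictlyTriangular w M) {n : ℕ} (hn : n ≠ 0) :
    IsStrictlyTriangular w (M ^ n) := by
  obtain ⟨n, rfl⟩ := Nat.exists_eq_succ_of_ne_zero hn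
  rw [pow_succ]
  exact h.mul_left (h.blockTriangular.pow n)

/-- Each factor raises the degree by at least one. -/
theorem IsStrictlyTriangular.pow_apply (h : IsStrictlyTriangular w M) (n : ℕ) (p q : ι)
    (hpq : w q < w p + n) : (M ^ n) p q = 0 := by
  induction n generalizing p with
  | zero => rw [pow_zero]; exact Matrix.one_apply_ne (by rintro rfl; omega)
  | succ n ih =>
    rw [pow_succ', Matrix.mul_apply]
    refine Finset.sum_eq_zero fun r _ => ?_
    rcases le_or_gt (w r) (w p) with hr | hr
    · rw [h p r hr, zero_mul]
    · rw [ih r (by omega), mul_zero]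

theorem IsStrictlyTriangular.isNilpotent (h : IsStrictlyTriangular w M) : IsNilpotent M := by
  refine ⟨Finset.univ.sup w + 1, Matrix.ext fun p q => h.pow_apply _ p q ?_⟩
  have := Finset.le_sup (f := w) (Finset.mem_univ q)
  omega

/-- Strictly triangular matrices form a two-sided ideal among the triangular ones, so congruence
modulo them is compatible with powers. -/
theorem IsStrictlyTriangular.pow_sub_pow (h : IsStrictlyTriangular w (M - M'))
    (h' : M'.BlockTriangular w) (n : ℕ) : IsStrictlyTriangular w (M ^ n - M' ^ n) := by
  have hM : M.BlockTriangular w := by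
    have := h.blockTriangular.add h'
    rwa [sub_add_cancel] at this
  induction n with
  | zero => intro p q _; simp
  | succ n ih =>
    have : M ^ (n + 1) - M' ^ (n + 1) = (M ^ n - M' ^ n) * M + M' ^ n * (M - M') := by
      rw [pow_succ, pow_succ]; noncomm_ring
    rw [this]
    exact (ih.mul_right hM).add (h.mul_left (h'.pow n))

end Triangular

/-! ### The block diagonal automorphisms -/

section Reductive

variable (m : ℕ) {R : Type u} [CommRing R]

theorem reductiveMatrix_inl_inl (A : Matrix (Fin 2) (Fin 2) R) (μ : R) (p q : Fin m × Fin 2) :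
    reductiveMatrix m A μ (Sum.inl p) (Sum.inl q) =
      if p.1 = q.1 then μ ^ (m - 1 - (p.1 : ℕ)) * A p.2 q.2 else 0 := by
  simp [reductiveMatrix, Matrix.kroneckerMap_apply, Matrix.diagonal_apply]

theorem reductiveMatrix_inr_inr (A : Matrix (Fin 2) (Fin 2) R) (μ : R) (a b : Fin 2) :
    reductiveMatrix m A μ (Sum.inr a) (Sum.inr b) =
      if a = b then ![μ ^ m * A.det, μ ^ (m - 1) * A.det] a else 0 := by
  simp [reductiveMatrix, Matrix.diagonal_apply]

theorem isHomogeneous_reductiveMatrix (A : Matrix (Fin 2) (Fin 2) R) (μ : R) :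
    IsHomogeneous (basisDegree m) (reductiveMatrix m A μ) := by
  rintro (p | a) (q | b) h
  · rw [reductiveMatrix_inl_inl, if_neg]
    exact fun h' => h (by simp [basisDegree, h'])
  · rfl
  · rfl
  · rw [reductiveMatrix_inr_inr, if_neg]
    rintro rfl
    exact h rfl

/-- The block diagonal matrices as a homomorphism of monoids. -/
def reductiveMatrixHom : Matrix (Fin 2) (Fin 2) R × R →*
    Matrix ((Fin m × Fin 2) ⊕ Fin 2) ((Fin m × Fin 2) ⊕ Fin 2) R where
  toFun x := reductiveMatrix m x.1 x.2
  map_one' := by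
    rw [reductiveMatrix]
    simp only [Prod.fst_one, Prod.snd_one, one_pow, Matrix.det_one, mul_one]
    have : Matrix.diagonal ![(1 : R), 1] = 1 := by
      ext i j; fin_cases i <;> fin_cases j <;> simp
    rw [this, Matrix.diagonal_one, Matrix.one_kronecker_one, Matrix.fromBlocks_one]
  map_mul' x y := by
    simp only [reductiveMatrix, Prod.fst_mul, Prod.snd_mul, Matrix.fromBlocks_multiply,
      Matrix.mul_zero, Matrix.zero_mul, add_zero, zero_add, ← Matrix.mul_kronecker_mul,
      Matrix.diagonal_mul_diagonal, mul_pow, Matrix.det_mul]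
    congr 1
    congr 1
    funext a
    fin_cases a <;> simp <;> ring

/-- The block diagonal matrices as a homomorphism `GL₂ × GL₁ → GL`. -/
def reductiveHom (R : Type u) [CommRing R] :
    GL (Fin 2) R × Rˣ →* GL ((Fin m × Fin 2) ⊕ Fin 2) R :=
  (Units.map (reductiveMatrixHom m)).comp MulEquiv.prodUnits.symm.toMonoidHom

theorem reductiveHom_val (A : GL (Fin 2) R) (μ : Rˣ) :
    (reductiveHom m R (A, μ)).val = reductiveMatrix m A.val μ := rfl

theorem symplecticBlock_conj (A : Matrix (Fin 2) (Fin 2) R) :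
    A * symplecticBlock R * Aᵀ = A.det • symplecticBlock R := by
  ext i j
  fin_cases i <;> fin_cases j <;>
    simp [symplecticBlock, Matrix.mul_apply, Fin.sum_univ_two, Matrix.det_fin_two] <;> ring

theorem reductiveHom_mem_autGroup [Algebra ℚ R] (x : GL (Fin 2) R × Rˣ) :
    reductiveHom m R x ∈ autGroup m R := by
  obtain ⟨A, μ⟩ := x
  rw [mem_autGroup_iff]
  have key : ∀ a, (Matrix.diagonal (fun i : Fin m => (μ : R) ^ (m - 1 - (i : ℕ))) ⊗ₖ A.val) *
      gramMatrix m R a * (Matrix.diagonal (fun i : Fin m => (μ : R) ^ (m - 1 - (i : ℕ))) ⊗ₖ A.val)ᵀ =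
      (Matrix.diagonal (fun i : Fin m => (μ : R) ^ (m - 1 - (i : ℕ))) * antidiagonalMatrix m R a *
        Matrix.diagonal (fun i : Fin m => (μ : R) ^ (m - 1 - (i : ℕ)))) ⊗ₖ
        (A.val.det • symplecticBlock R) := by
    intro a
    rw [← Matrix.kroneckerMap_transpose, Matrix.diagonal_transpose, gramMatrix,
      ← Matrix.mul_kronecker_mul, ← Matrix.mul_kronecker_mul, symplecticBlock_conj]
  simp only [reductiveHom_val, reductiveMatrix, Matrix.toBlocks_fromBlocks₂₁,
    Matrix.toBlocks_fromBlocks₁₁, Matrix.toBlocks_fromBlocks₂₂, true_and, key]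
  intro a
  ext ⟨i, c⟩ ⟨j, d⟩
  -- The forms live on antidiagonals, where i + j is constant, so the two powers of μ multiply to a
  -- constant: μ^m for f and μ^(m-1) for e.
  have e1 : ∀ h : (i : ℕ) + j + 2 = m, (μ : R) ^ m = μ ^ (m - 1 - (i : ℕ)) * μ ^ (m - 1 - (j : ℕ)) :=
    fun h => by rw [← pow_add]; congr 1; omega
  have e2 : ∀ h : (i : ℕ) + j + 1 = m,
      (μ : R) ^ (m - 1) = μ ^ (m - 1 - (i : ℕ)) * μ ^ (m - 1 - (j : ℕ)) :=
    fun h => by rw [← pow_add]; congr 1; omega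
  fin_cases a
  · by_cases h : (i : ℕ) + j + 2 = m
    · simp [Matrix.kroneckerMap_apply, antidiagonalMatrix, gramMatrix_apply, h]
      rw [e1 h]
      ring
    · simp [Matrix.kroneckerMap_apply, antidiagonalMatrix, gramMatrix_apply, h]
  · by_cases h : (i : ℕ) + j + 1 = m
    · simp [Matrix.kroneckerMap_apply, antidiagonalMatrix, gramMatrix_apply, h]
      rw [e2 h]
      ring
    · simp [Matrix.kroneckerMap_apply, antidiagonalMatrix, gramMatrix_apply, h]

end Reductive

/-! ### Shape of the automorphisms -/

section Shape

variable (m : ℕ) (R : Type u) [CommRing R]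

/-- The nilpotent Jordan block. -/
def jordanBlock : Matrix (Fin m) (Fin m) R := Matrix.of fun i j => if (i : ℕ) + 1 = j then 1 else 0

/-- The shift of the pairs of basis vectors. -/
def shiftMatrix : Matrix (Fin m × Fin 2) (Fin m × Fin 2) R := jordanBlock m R ⊗ₖ 1

theorem shiftMatrix_apply (p q : Fin m × Fin 2) :
    shiftMatrix m R p q = if (p.1 : ℕ) + 1 = q.1 ∧ p.2 = q.2 then 1 else 0 := by
  simp [shiftMatrix, jordanBlock, Matrix.kroneckerMap_apply, Matrix.one_apply, ite_and]
  split_ifs <;> rfl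

variable {m R}

theorem shiftMatrix_mul_apply (M : Matrix (Fin m × Fin 2) (Fin m × Fin 2) R) {i i' : Fin m}
    (h : (i : ℕ) + 1 = i') (a : Fin 2) (q : Fin m × Fin 2) :
    (shiftMatrix m R * M) (i, a) q = M (i', a) q := by
  rw [Matrix.mul_apply, Finset.sum_eq_single (i', a)]
  · simp [shiftMatrix_apply, h]
  · rintro ⟨k, c⟩ _ hk
    rw [shiftMatrix_apply, if_neg, zero_mul]
    rintro ⟨h1, h2⟩
    exact hk (Prod.ext (Fin.ext (by simp only at h1 ⊢; omega)) h2.symm)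
  · simp

theorem mul_shiftMatrix_apply (M : Matrix (Fin m × Fin 2) (Fin m × Fin 2) R) {j j' : Fin m}
    (h : (j : ℕ) + 1 = j') (b : Fin 2) (p : Fin m × Fin 2) :
    (M * shiftMatrix m R) p (j', b) = M p (j, b) := by
  rw [Matrix.mul_apply, Finset.sum_eq_single (j, b)]
  · simp [shiftMatrix_apply, h]
  · rintro ⟨k, c⟩ _ hk
    rw [shiftMatrix_apply, if_neg, mul_zero]
    rintro ⟨h1, h2⟩
    exact hk (Prod.ext (Fin.ext (by simp only at h1 ⊢; omega)) h2)
  · simp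

theorem mul_shiftMatrix_apply_zero (M : Matrix (Fin m × Fin 2) (Fin m × Fin 2) R) {j : Fin m}
    (h : (j : ℕ) = 0) (b : Fin 2) (p : Fin m × Fin 2) :
    (M * shiftMatrix m R) p (j, b) = 0 := by
  rw [Matrix.mul_apply]
  refine Finset.sum_eq_zero fun k _ => ?_
  rw [shiftMatrix_apply, if_neg, mul_zero]
  rintro ⟨h1, -⟩
  simp [h] at h1

variable (m R) in
-- The whole structure is thereby reduced to one nondegenerate form and one nilpotent operator.
theorem gramMatrix_zero_eq : gramMatrix m R 0 = shiftMatrix m R * gramMatrix m R 1 := by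
  rw [gramMatrix, shiftMatrix, gramMatrix, ← Matrix.mul_kronecker_mul, one_mul]
  congr 1
  ext i j
  rw [Matrix.mul_apply]
  by_cases h : (i : ℕ) + j + 2 = m
  · have hi : (i : ℕ) + 1 < m := by omega
    rw [Finset.sum_eq_single ⟨i + 1, hi⟩]
    · have : (i : ℕ) + 1 + j + 1 = m := by omega
      simp [antidiagonalMatrix, jordanBlock, h, this]
    · intro k _ hk
      have : ¬ ((i : ℕ) + 1 = k) := fun h => hk (Fin.ext h.symm)
      simp [jordanBlock, this]
    · simp
  · rw [Finset.sum_eq_zero]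
    · simp [antidiagonalMatrix, h]
    · intro k _
      by_cases hk : (i : ℕ) + 1 = k
      · have : ¬ ((k : ℕ) + j + 1 = m) := by omega
        simp [antidiagonalMatrix, this]
      · simp [jordanBlock, hk]

theorem det_smul_one_add_smul_shiftMatrix (x y : R) :
    (x • (1 : Matrix (Fin m × Fin 2) (Fin m × Fin 2) R) + y • shiftMatrix m R).det =
      x ^ (2 * m) := by
  have h1 : x • (1 : Matrix (Fin m × Fin 2) (Fin m × Fin 2) R) + y • shiftMatrix m R =
      (x • (1 : Matrix (Fin m) (Fin m) R) + y • jordanBlock m R) ⊗ₖ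
        (1 : Matrix (Fin 2) (Fin 2) R) := by
    rw [Matrix.add_kronecker, Matrix.smul_kronecker, Matrix.smul_kronecker,
      Matrix.one_kronecker_one, shiftMatrix]
  have h2 : (x • (1 : Matrix (Fin m) (Fin m) R) + y • jordanBlock m R).det = x ^ m := by
    rw [Matrix.det_of_isUpperTriangular]
    · simp [jordanBlock]
    · intro i j hij
      have hij' : (j : ℕ) < i := hij
      have : ¬ ((i : ℕ) + 1 = j) := by omega
      have h : i ≠ j := fun h => by simp [h] at hij'
      simp [jordanBlock, this, h]
  rw [h1, Matrix.det_kronecker, h2]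
  simp [← pow_mul, mul_comm]

/-- Expanding, (x + y)^n - x^n = y (n x^(n-1) + k y), and the second factor is a unit plus a
nilpotent. This handles rings R with nilpotents, where y^n = 0 alone would not give y = 0. -/
theorem eq_zero_of_add_pow_eq_pow [Algebra ℚ R] {x y : R} (hx : IsUnit x) (hy : IsNilpotent y)
    {n : ℕ} (hn : n ≠ 0) (h : (x + y) ^ n = x ^ n) : y = 0 := by
  obtain ⟨k, hk⟩ := Polynomial.powAddExpansion x y n
  have hu : IsUnit ((n : R) * x ^ (n - 1)) := by
    refine IsUnit.mul ?_ (hx.pow _)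
    have : (n : R) = algebraMap ℚ R n := by simp
    rw [this]
    exact (isUnit_iff_ne_zero.2 (by exact_mod_cast hn)).map _
  have hu' : IsUnit ((n : R) * x ^ (n - 1) + k * y) :=
    IsNilpotent.isUnit_add_left_of_commute ((Commute.all _ _).isNilpotent_mul_left hy) hu
      (Commute.all _ _)
  refine (hu'.mul_left_eq_zero).1 ?_
  linear_combination h - hk

theorem isUnit_det_gramMatrix_one : IsUnit (gramMatrix m R 1).det := by
  refine IsUnit.of_mul_eq_one ((-gramMatrix m R 1).det) ?_
  rw [← Matrix.det_mul, Matrix.mul_neg, gramMatrix_one_mul_self, neg_neg, Matrix.det_one]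

variable {T : Matrix (Fin m × Fin 2) (Fin m × Fin 2) R} {a b c d : R}

theorem pencil_eq (x y : R) : y • gramMatrix m R 0 + x • gramMatrix m R 1 =
    (x • 1 + y • shiftMatrix m R) * gramMatrix m R 1 := by
  rw [gramMatrix_zero_eq, add_mul, smul_mul_assoc, smul_mul_assoc, one_mul, add_comm]

theorem det_pencil (x y : R) : (y • gramMatrix m R 0 + x • gramMatrix m R 1).det =
    x ^ (2 * m) * (gramMatrix m R 1).det := by
  rw [pencil_eq, Matrix.det_mul, det_smul_one_add_smul_shiftMatrix]

theorem det_sq_mul_of_conj_pencil {x y x' y' : R}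
    (h : T * (y • gramMatrix m R 0 + x • gramMatrix m R 1) * Tᵀ =
      y' • gramMatrix m R 0 + x' • gramMatrix m R 1) :
    T.det ^ 2 * x ^ (2 * m) = x' ^ (2 * m) := by
  have := congrArg Matrix.det h
  rw [Matrix.det_mul, Matrix.det_mul, Matrix.det_transpose, det_pencil, det_pencil] at this
  refine (isUnit_det_gramMatrix_one (m := m) (R := R)).mul_right_cancel ?_
  linear_combination this

/-- The determinant of the pencil is evaluated at P_e, P_f and P_e + P_f: this gives det T² =
a^(2m), b^(2m) = 0 and (a + b)^(2m) = a^(2m). -/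
theorem coefficient_eq_zero [Algebra ℚ R] (hm : 1 ≤ m) (hT : IsUnit T.det)
    (h0 : T * gramMatrix m R 0 * Tᵀ = d • gramMatrix m R 0 + b • gramMatrix m R 1)
    (h1 : T * gramMatrix m R 1 * Tᵀ = c • gramMatrix m R 0 + a • gramMatrix m R 1) :
    IsUnit a ∧ b = 0 := by
  have ha : T.det ^ 2 * 1 ^ (2 * m) = a ^ (2 * m) :=
    det_sq_mul_of_conj_pencil (y := 0) (y' := c) (by simpa using h1)
  have hb : T.det ^ 2 * 0 ^ (2 * m) = b ^ (2 * m) :=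
    det_sq_mul_of_conj_pencil (y := 1) (y' := d) (by simpa using h0)
  have hab : T.det ^ 2 * 1 ^ (2 * m) = (a + b) ^ (2 * m) := by
    refine det_sq_mul_of_conj_pencil (y := 1) (y' := c + d) ?_
    rw [one_smul, one_smul, mul_add, add_mul, h0, h1]
    module
  have hm' : 2 * m ≠ 0 := by omega
  have hau : IsUnit a := by
    refine (isUnit_pow_iff hm').1 ?_
    rw [← ha, one_pow, mul_one]
    exact hT.pow 2
  rw [zero_pow hm', mul_zero] at hb
  exact ⟨hau, eq_zero_of_add_pow_eq_pow hau ⟨_, hb.symm⟩ hm' (hab.symm.trans ha)⟩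

/-- With v = a + cJ, the two hypotheses say that T J T⁻¹ = d J v⁻¹. The unit v commutes with J, so
the inverses can be cleared. -/
theorem shift_relation (ha : IsUnit a) (hT : IsUnit T.det)
    (h0 : T * gramMatrix m R 0 * Tᵀ = d • gramMatrix m R 0)
    (h1 : T * gramMatrix m R 1 * Tᵀ = c • gramMatrix m R 0 + a • gramMatrix m R 1) :
    a • (T * shiftMatrix m R) + c • (shiftMatrix m R * T * shiftMatrix m R) =
      d • (shiftMatrix m R * T) := by
  set J := shiftMatrix m R with hJ
  set P := gramMatrix m R 1 with hP
  have hPP : P * P = -1 := gramMatrix_one_mul_self m R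
  set v := a • (1 : Matrix (Fin m × Fin 2) (Fin m × Fin 2) R) + c • J with hv
  have hvu : IsUnit v := by
    rw [Matrix.isUnit_iff_isUnit_det, hv, hJ, det_smul_one_add_smul_shiftMatrix]
    exact ha.pow _
  obtain ⟨v', hv'⟩ := hvu
  obtain ⟨t, ht⟩ := (Matrix.isUnit_iff_isUnit_det T).2 hT
  have hvJ : v * J = J * v := by simp [hv, add_mul, mul_add]
  -- S is the adjoint of T for the form P, as P⁻¹ = -P. The hypotheses become T S = v and T J S = d
  -- J, and S is then eliminated.
  set S := -(P * Tᵀ * P) with hS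
  have hTS : T * S = v := by
    have : T * S = -(T * P * Tᵀ) * P := by rw [hS]; noncomm_ring
    rw [this, h1, pencil_eq, neg_mul, mul_assoc, ← hP, hPP]
    simp [hv, hJ]
  have hTJS : T * J * S = d • J := by
    have : T * J * S = -(T * (J * P) * Tᵀ) * P := by rw [hS]; noncomm_ring
    rw [this, hJ, hP, ← gramMatrix_zero_eq, h0, gramMatrix_zero_eq, neg_mul, smul_mul_assoc,
      mul_assoc, ← hP, hPP]
    simp
  have hS' : S = (t⁻¹).val * v := by rw [← hTS, ← ht, ← mul_assoc]; simp
  have h3 : T * J * (t⁻¹).val = d • J * (v'⁻¹).val := by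
    rw [← hTJS, hS', ← hv']
    simp [mul_assoc]
  have h4 : v * (T * J * (t⁻¹).val) = d • J := by
    rw [h3, ← mul_assoc, mul_smul_comm, hvJ, ← hv', smul_mul_assoc, mul_assoc]
    simp
  have h5 : v * (T * J) = d • J * T := by
    rw [← h4, ← ht]
    simp [mul_assoc]
  rw [hv, add_mul, smul_mul_assoc, smul_mul_assoc, one_mul, smul_mul_assoc] at h5
  rw [mul_assoc, h5]

/-- Induction on the column: the relation expresses d times block (i, j) through blocks (i-1, j-1)
and (i, j-1), which also lie below the diagonal, and the left side vanishes in column 0. -/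
theorem eq_zero_of_shift_relation (hd : IsUnit d)
    (h : a • (T * shiftMatrix m R) + c • (shiftMatrix m R * T * shiftMatrix m R) =
      d • (shiftMatrix m R * T)) (n : ℕ) :
    ∀ i j : Fin m, (j : ℕ) = n → j < i → ∀ α β, T (i, α) (j, β) = 0 := by
  induction n with
  | zero =>
    intro i j hj hij α β
    have hi : (i : ℕ) - 1 + 1 = i := by have : (j : ℕ) < i := hij; omega
    have := congrFun (congrFun h (⟨(i : ℕ) - 1, by omega⟩, α)) (j, β)
    rw [Matrix.add_apply, Matrix.smul_apply, Matrix.smul_apply, Matrix.smul_apply,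
      mul_shiftMatrix_apply_zero _ hj, mul_shiftMatrix_apply_zero _ hj,
      shiftMatrix_mul_apply (i' := i) _ hi] at this
    simpa [hd.mul_right_eq_zero] using this.symm
  | succ n ih =>
    intro i j hj hij α β
    have hij' : (j : ℕ) < i := hij
    have hi : (i : ℕ) - 1 + 1 = i := by omega
    have := congrFun (congrFun h (⟨(i : ℕ) - 1, by omega⟩, α)) (j, β)
    rw [Matrix.add_apply, Matrix.smul_apply, Matrix.smul_apply, Matrix.smul_apply,
      mul_shiftMatrix_apply (j := ⟨n, by omega⟩) _ hj.symm,
      mul_shiftMatrix_apply (j := ⟨n, by omega⟩) _ hj.symm,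
      shiftMatrix_mul_apply (i' := i) _ hi, shiftMatrix_mul_apply (i' := i) _ hi,
      ih _ ⟨n, by omega⟩ rfl (by rw [Fin.lt_def]; simp only; omega),
      ih i ⟨n, by omega⟩ rfl (by rw [Fin.lt_def]; simp only; omega)] at this
    simpa [hd.mul_right_eq_zero] using this.symm

theorem shift_relation_apply
    (h : a • (T * shiftMatrix m R) + c • (shiftMatrix m R * T * shiftMatrix m R) =
      d • (shiftMatrix m R * T)) {i i' j j' : Fin m} (hi : (i : ℕ) + 1 = i') (hj : (j : ℕ) + 1 = j')
    (α β : Fin 2) :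
    a * T (i, α) (j, β) + c * T (i', α) (j, β) = d * T (i', α) (j', β) := by
  have := congrFun (congrFun h (i, α)) (j', β)
  rwa [Matrix.add_apply, Matrix.smul_apply, Matrix.smul_apply, Matrix.smul_apply,
    mul_shiftMatrix_apply _ hj, mul_shiftMatrix_apply _ hj, shiftMatrix_mul_apply _ hi,
    shiftMatrix_mul_apply _ hi] at this

theorem mul_gramMatrix_one_mul_transpose_apply (T S : Matrix (Fin m × Fin 2) (Fin m × Fin 2) R)
    (p q : Fin m × Fin 2) :
    (T * gramMatrix m R 1 * Sᵀ) p q =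
      ∑ k : Fin m, (T p (k, 0) * S q (k.rev, 1) - T p (k, 1) * S q (k.rev, 0)) := by
  have h1 : ∀ (k : Fin m) (α : Fin 2), (gramMatrix m R 1 * Sᵀ) (k, α) q =
      if α = 0 then S q (k.rev, 1) else - S q (k.rev, 0) := by
    intro k α
    rw [Matrix.mul_apply, Fintype.sum_prod_type, Finset.sum_eq_single k.rev]
    · have : (k : ℕ) + (m - (k + 1)) + 1 = m := by omega
      fin_cases α <;> simp [gramMatrix_apply, symplecticBlock, Fin.val_rev, this]
    · intro l _ hl
      have : ¬ ((k : ℕ) + l + 1 = m) := fun h => hl (Fin.ext (by rw [Fin.val_rev]; omega))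
      simp [gramMatrix_apply, this]
    · simp
  rw [mul_assoc, Matrix.mul_apply, Fintype.sum_prod_type]
  refine Finset.sum_congr rfl fun k _ => ?_
  rw [Fin.sum_univ_two, h1, h1]
  simp [sub_eq_add_neg]

end Shape

/-- An automorphism is block upper triangular, and its block diagonal part is one of the
automorphisms `reductiveHom`. -/
theorem exists_reductiveHom_sub_strict {m : ℕ} (hm : 1 ≤ m) {R : Type u} [CommRing R] [Algebra ℚ R]
    {g : GL ((Fin m × Fin 2) ⊕ Fin 2) R} (hg : g ∈ autGroup m R) :
    ∃ x, IsStrictlyTriangular (basisDegree m) (g.val - (reductiveHom m R x).val) := by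
  obtain ⟨hC, hT⟩ := (mem_autGroup_iff m R g).1 hg
  have hdet : IsUnit (g.val.toBlocks₁₁.det * g.val.toBlocks₂₂.det) := by
    rw [← Matrix.det_fromBlocks_zero₂₁ _ g.val.toBlocks₁₂, ← hC, Matrix.fromBlocks_toBlocks]
    exact (Matrix.isUnit_iff_isUnit_det _).1 g.isUnit
  set T := g.val.toBlocks₁₁ with hTdef
  set B := g.val.toBlocks₂₂ with hBdef
  have hTu := isUnit_of_mul_isUnit_left hdet
  obtain ⟨ha, hb⟩ := coefficient_eq_zero hm hTu (hT 0) (hT 1)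
  have hd : IsUnit (B 0 0) := by
    have := isUnit_of_mul_isUnit_right hdet
    rw [Matrix.det_fin_two, hb, mul_zero, sub_zero] at this
    exact isUnit_of_mul_isUnit_left this
  have h0 := hT 0
  rw [hb, zero_smul, add_zero] at h0
  have hrel := shift_relation ha hTu h0 (hT 1)
  have hzero : ∀ i j : Fin m, j < i → ∀ α β, T (i, α) (j, β) = 0 := fun i j =>
    eq_zero_of_shift_relation hd hrel _ i j rfl
  obtain ⟨a, ha'⟩ := ha
  obtain ⟨d, hd'⟩ := hd
  -- The relation on the diagonal reads a T_(i,i) = d T_(i+1,i+1), so μ is the ratio of consecutive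
  -- diagonal blocks.
  set μ : Rˣ := a⁻¹ * d with hμ
  have hμd : (d : R) = a * μ := by rw [hμ, ← Units.val_mul]; simp
  let l : Fin m := ⟨m - 1, by omega⟩
  let A : Matrix (Fin 2) (Fin 2) R := Matrix.of fun α β => T (l, α) (l, β)
  -- The induction runs upwards from the last block A, where the exponent of μ is 0.
  have hdiag : ∀ n : ℕ, ∀ i : Fin m, m - 1 - (i : ℕ) = n → ∀ α β,
      T (i, α) (i, β) = (μ : R) ^ n * A α β := by
    intro n
    induction n with
    | zero =>
      intro i hi α β
      have : i = l := Fin.ext (by simp only [l]; omega)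
      rw [this, pow_zero, one_mul]; rfl
    | succ n ih =>
      intro i hi α β
      have h := shift_relation_apply hrel (i := i) (i' := ⟨i + 1, by omega⟩) (j := i)
        (j' := ⟨i + 1, by omega⟩) rfl rfl α β
      rw [hzero ⟨i + 1, by omega⟩ i (by rw [Fin.lt_def]; simp), mul_zero, add_zero,
        ih ⟨i + 1, by omega⟩ (by simp only; omega), ← ha', ← hd', hμd] at h
      refine a.isUnit.mul_left_cancel (h.trans ?_)
      ring
  -- In the relation for P_e, the entry pairing the first with the last block row involves only the
  -- two corner diagonal blocks, because the last row of T has no other block.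
  have hdetA : (a : R) = μ ^ (m - 1) * A.det := by
    have h := congrFun (congrFun (hT 1) (⟨0, hm⟩, 0)) (l, 1)
    rw [mul_gramMatrix_one_mul_transpose_apply, Finset.sum_eq_single ⟨0, hm⟩] at h
    · have e : (⟨0, hm⟩ : Fin m).rev = l := Fin.ext (by rw [Fin.val_rev])
      have e2 : m - 1 + 1 = m := by omega
      have e3 : ¬ (m - 1 + 2 = m) := by omega
      rw [hdiag (m - 1) ⟨0, hm⟩ (by simp), hdiag (m - 1) ⟨0, hm⟩ (by simp), e] at h
      simp [gramMatrix_apply, symplecticBlock, l, e2, e3, ← ha'] at h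
      rw [Matrix.det_fin_two, ← h]
      simp only [A, Matrix.of_apply, l]
      ring
    · intro k _ hk
      have : k.rev < l := by
        rw [Fin.lt_def, Fin.val_rev]
        simp only [l]
        have : (k : ℕ) ≠ 0 := fun h => hk (Fin.ext h)
        omega
      simp [hzero _ _ this]
    · simp
  have hA : IsUnit A.det := isUnit_of_mul_isUnit_right (hdetA ▸ a.isUnit)
  refine ⟨(Matrix.nonsingInvUnit A hA, μ), ?_⟩
  have hval : (Matrix.nonsingInvUnit A hA).val = A := rfl
  rintro (⟨i, α⟩ | α) (⟨j, β⟩ | β) h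
  · rw [Matrix.sub_apply, reductiveHom_val, hval, reductiveMatrix_inl_inl]
    change T (i, α) (j, β) - _ = 0
    have h' : j ≤ i := h
    rcases h'.lt_or_eq with h' | rfl
    · rw [hzero _ _ h', if_neg (by rintro rfl; simp at h'), sub_zero]
    · rw [if_pos rfl, hdiag _ _ rfl, sub_self]
  · simp [basisDegree] at h
    omega
  · rw [Matrix.sub_apply]
    have : g.val (Sum.inr α) (Sum.inl (j, β)) = 0 := congrFun (congrFun hC α) (j, β)
    rw [this, reductiveHom_val, isHomogeneous_reductiveMatrix m _ _ (Sum.inr α) (Sum.inl (j, β))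
      (by simp [basisDegree]; omega), sub_zero]
  · rw [Matrix.sub_apply, reductiveHom_val, hval, reductiveMatrix_inr_inr]
    change B α β - _ = 0
    have hm' : m = m - 1 + 1 := by omega
    have hd2 : (d : R) = μ ^ m * A.det := by
      rw [hμd, hdetA]; conv_rhs => rw [hm', pow_succ]
      ring
    fin_cases α <;> fin_cases β
    · simp [← hd', hd2]
    · simp [basisDegree] at h
    · simpa using hb
    · simp [← ha', hdetA]

/-! ### The closed subgroups -/

/-- Both N and H are cut out of the automorphism group by prescribing some entries to be those of
the identity matrix; E selects these positions. -/
theorem AlgSubgroup.exists_equations_inter {ι : Type} [Fintype ι] [DecidableEq ι]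
    (G : AlgSubgroup.{u} ι) (E : ι → ι → Prop) :
    ∃ S : Set (MvPolynomial (ι × ι) ℚ), ∀ (R : Type u) [CommRing R] [Algebra ℚ R] (g : GL ι R),
      (g ∈ G.pts R ∧ ∀ p q, E p q → g.val p q = (1 : Matrix ι ι R) p q) ↔
        ∀ p ∈ S, MvPolynomial.aeval (fun ij : ι × ι => g.val ij.1 ij.2) p = 0 := by
  obtain ⟨S, hS⟩ := G.exists_equations
  refine ⟨S ∪ {P | ∃ p q, E p q ∧
    P = MvPolynomial.X (p, q) - MvPolynomial.C ((1 : Matrix ι ι ℚ) p q)}, fun R _ _ g => ?_⟩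
  rw [hS]
  have e : ∀ p q, MvPolynomial.aeval (fun ij : ι × ι => g.val ij.1 ij.2)
      (MvPolynomial.X (p, q) - MvPolynomial.C ((1 : Matrix ι ι ℚ) p q)) =
        g.val p q - (1 : Matrix ι ι R) p q := by
    intro p q
    simp only [map_sub, MvPolynomial.aeval_X, MvPolynomial.aeval_C, Matrix.one_apply]
    split_ifs <;> simp
  constructor
  · rintro ⟨h1, h2⟩ P (hP | ⟨p, q, hpq, rfl⟩)
    · exact h1 P hP
    · rw [e, h2 p q hpq, sub_self]
  · intro h
    refine ⟨fun P hP => h P (Or.inl hP), fun p q hpq => ?_⟩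
    rw [← sub_eq_zero, ← e]
    exact h _ (Or.inr ⟨p, q, hpq, rfl⟩)

section Groups

variable {m : ℕ} {R : Type u} [CommRing R] [Algebra ℚ R]

theorem blockTriangular_of_mem_autGroup (hm : 1 ≤ m) {g : GL ((Fin m × Fin 2) ⊕ Fin 2) R}
    (hg : g ∈ autGroup m R) : g.val.BlockTriangular (basisDegree m) := by
  obtain ⟨x, hx⟩ := exists_reductiveHom_sub_strict hm hg
  have := hx.blockTriangular.add (isHomogeneous_reductiveMatrix m x.1.val x.2.val).blockTriangular
  rwa [reductiveHom_val, sub_add_cancel] at this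

variable (m R) in
/-- The automorphisms acting trivially on the associated graded space. -/
def unipotentPoints (hm : 1 ≤ m) : Subgroup (GL ((Fin m × Fin 2) ⊕ Fin 2) R) where
  carrier := {g | g ∈ autGroup m R ∧ IsStrictlyTriangular (basisDegree m) (g.val - 1)}
  one_mem' := ⟨one_mem _, by intro p q _; simp⟩
  mul_mem' := by
    rintro g h ⟨hg, hg'⟩ ⟨hh, hh'⟩
    refine ⟨mul_mem hg hh, ?_⟩
    have : (g * h).val - 1 = (g.val - 1) * h.val + (h.val - 1) := by
      rw [Units.val_mul]; noncomm_ring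
    rw [this]
    exact (hg'.mul_right (blockTriangular_of_mem_autGroup hm hh)).add hh'
  inv_mem' := by
    rintro g ⟨hg, hg'⟩
    refine ⟨inv_mem hg, ?_⟩
    have : (g⁻¹).val - 1 = -((g⁻¹).val * (g.val - 1)) := by
      rw [mul_sub, ← Units.val_mul]; simp
    rw [this]
    exact (hg'.mul_left (blockTriangular_of_mem_autGroup hm (inv_mem hg))).neg

theorem mem_unipotentPoints {hm : 1 ≤ m} {g : GL ((Fin m × Fin 2) ⊕ Fin 2) R} :
    g ∈ unipotentPoints m R hm ↔
      g ∈ autGroup m R ∧ IsStrictlyTriangular (basisDegree m) (g.val - 1) := Iff.rfl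

theorem conj_mem_unipotentPoints (hm : 1 ≤ m) {g n : GL ((Fin m × Fin 2) ⊕ Fin 2) R}
    (hg : g ∈ autGroup m R) (hn : n ∈ unipotentPoints m R hm) :
    g * n * g⁻¹ ∈ unipotentPoints m R hm := by
  refine ⟨mul_mem (mul_mem hg hn.1) (inv_mem hg), ?_⟩
  have : (g * n * g⁻¹).val - 1 = g.val * (n.val - 1) * (g⁻¹).val := by
    rw [mul_sub, sub_mul, mul_one, ← Units.val_mul g g⁻¹]; simp
  rw [this]
  exact (hn.2.mul_left (blockTriangular_of_mem_autGroup hm hg)).mul_right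
    (blockTriangular_of_mem_autGroup hm (inv_mem hg))

theorem mul_inv_mem_unipotentPoints (hm : 1 ≤ m) {g h : GL ((Fin m × Fin 2) ⊕ Fin 2) R}
    (hg : g ∈ autGroup m R) (hh : h ∈ autGroup m R)
    (hgh : IsStrictlyTriangular (basisDegree m) (g.val - h.val)) :
    g * h⁻¹ ∈ unipotentPoints m R hm := by
  refine ⟨mul_mem hg (inv_mem hh), ?_⟩
  have : (g * h⁻¹).val - 1 = (g.val - h.val) * (h⁻¹).val := by
    rw [sub_mul, ← Units.val_mul h h⁻¹]; simp
  rw [this]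
  exact hgh.mul_right (blockTriangular_of_mem_autGroup hm (inv_mem hh))

theorem exists_mul_eq (hm : 1 ≤ m) {g : GL ((Fin m × Fin 2) ⊕ Fin 2) R} (hg : g ∈ autGroup m R) :
    ∃ n ∈ unipotentPoints m R hm, ∃ x, g = n * reductiveHom m R x := by
  obtain ⟨x, hx⟩ := exists_reductiveHom_sub_strict hm hg
  exact ⟨_, mul_inv_mem_unipotentPoints hm hg (reductiveHom_mem_autGroup m x) hx, x, by simp⟩

variable (m R) in
/-- The block diagonal automorphisms. -/
def reductivePoints : Subgroup (GL ((Fin m × Fin 2) ⊕ Fin 2) R) := (reductiveHom m R).range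

/-- An intrinsic description of the image of a homomorphism, from which its polynomial equations can
be read off. -/
theorem mem_reductivePoints_iff (hm : 1 ≤ m) {g : GL ((Fin m × Fin 2) ⊕ Fin 2) R} :
    g ∈ reductivePoints m R ↔ g ∈ autGroup m R ∧ IsHomogeneous (basisDegree m) g.val := by
  constructor
  · rintro ⟨x, rfl⟩
    exact ⟨reductiveHom_mem_autGroup m x, isHomogeneous_reductiveMatrix m _ _⟩
  · rintro ⟨hg, h⟩
    obtain ⟨x, hx⟩ := exists_reductiveHom_sub_strict hm hg
    refine ⟨x, Units.ext ?_⟩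
    exact (sub_eq_zero.1 ((h.sub (isHomogeneous_reductiveMatrix m _ _)).eq_zero hx)).symm

theorem unipotentPoints_inf_reductivePoints (hm : 1 ≤ m) :
    unipotentPoints m R hm ⊓ reductivePoints m R = ⊥ := by
  rw [eq_bot_iff]
  rintro g ⟨hg, hg'⟩
  exact Subgroup.mem_bot.2 (Units.ext (sub_eq_zero.1
    ((((mem_reductivePoints_iff hm).1 hg').2.sub isHomogeneous_one).eq_zero hg.2)))

end Groups

theorem reductiveHom_injective {m : ℕ} {R : Type u} [CommRing R] (hm : 1 ≤ m) :
    Function.Injective (reductiveHom m R) := by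
  rw [injective_iff_map_eq_one]
  rintro ⟨A, μ⟩ h
  have h' : reductiveMatrix m A.val (μ : R) = 1 := congrArg Units.val h
  have hA : A.val = 1 := by
    ext i j
    have := congrFun (congrFun h' (Sum.inl (⟨m - 1, by omega⟩, i))) (Sum.inl (⟨m - 1, by omega⟩, j))
    rw [reductiveMatrix_inl_inl] at this
    simpa [Matrix.one_apply] using this
  -- The quotient of the two central entries recovers μ; this works also for m = 1, where the upper
  -- blocks do not involve μ.
  have e1 := congrFun (congrFun h' (Sum.inr 0)) (Sum.inr 0)
  have e2 := congrFun (congrFun h' (Sum.inr 1)) (Sum.inr 1)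
  rw [reductiveMatrix_inr_inr] at e1 e2
  simp [hA] at e1 e2
  have hm' : m = m - 1 + 1 := by omega
  have hμ : (μ : R) = 1 := by
    rw [hm', pow_succ, e2, one_mul] at e1
    exact e1
  exact Prod.ext (Units.ext hA) (Units.ext hμ)

theorem map_reductiveMatrix (m : ℕ) {R S : Type*} [CommRing R] [CommRing S] (φ : R →+* S)
    (A : Matrix (Fin 2) (Fin 2) R) (μ : R) :
    (reductiveMatrix m A μ).map φ = reductiveMatrix m (A.map φ) (φ μ) := by
  have hdet : (A.map φ).det = φ A.det := (RingHom.map_det φ A).symm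
  ext (p | a) (q | b)
  · rw [Matrix.map_apply, reductiveMatrix_inl_inl, reductiveMatrix_inl_inl]
    split_ifs <;> simp
  · exact map_zero φ
  · exact map_zero φ
  · rw [Matrix.map_apply, reductiveMatrix_inr_inr, reductiveMatrix_inr_inr, hdet]
    fin_cases a <;> fin_cases b <;> simp

/-- The automorphisms acting trivially on the associated graded space, as an algebraic group. -/
def unipotentGroup (m : ℕ) (hm : 1 ≤ m) : AlgSubgroup.{u} ((Fin m × Fin 2) ⊕ Fin 2) where
  pts R _ _ := unipotentPoints m R hm
  exists_equations := by
    obtain ⟨S, hS⟩ := (algebraicAutGroup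
      (DStarLieAlgebra.basisC m (Polynomial.X ^ m))).exists_equations_inter
        fun p q => basisDegree m q ≤ basisDegree m p
    refine ⟨S, fun R _ _ g => ?_⟩
    rw [← hS, mem_unipotentPoints]
    simp only [IsStrictlyTriangular, Matrix.sub_apply, sub_eq_zero]
    rfl

/-- The block diagonal automorphisms, as an algebraic group. -/
def reductiveGroup (m : ℕ) (hm : 1 ≤ m) : AlgSubgroup.{u} ((Fin m × Fin 2) ⊕ Fin 2) where
  pts R _ _ := reductivePoints m R
  exists_equations := by
    obtain ⟨S, hS⟩ := (algebraicAutGroup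
      (DStarLieAlgebra.basisC m (Polynomial.X ^ m))).exists_equations_inter
        fun p q => basisDegree m p ≠ basisDegree m q
    refine ⟨S, fun R _ _ g => ?_⟩
    rw [← hS, mem_reductivePoints_iff hm]
    refine and_congr Iff.rfl (forall_congr' fun p => forall_congr' fun q => forall_congr' fun h => ?_)
    rw [Matrix.one_apply_ne fun h' => h (congrArg _ h')]

/-- The isomorphism of `GL₂ × GL₁` with the group of block diagonal automorphisms. -/
noncomputable def reductiveIso (m : ℕ) (hm : 1 ≤ m) :
    AlgSubgroup.IsoGLTwoGLOne (reductiveGroup.{u} m hm) where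
  equiv _ _ _ := MonoidHom.ofInjective (reductiveHom_injective hm)
  natural R S _ _ _ _ φ A μ :=
    Units.ext (map_reductiveMatrix m (φ : R →+* S) A.val (μ : R)).symm

theorem isSemidirectProduct_autGroup (m : ℕ) (hm : 1 ≤ m) :
    AlgSubgroup.IsSemidirectProduct
      (algebraicAutGroup.{u} (DStarLieAlgebra.basisC m (Polynomial.X ^ m)))
      (unipotentGroup m hm) (reductiveGroup m hm) := by
  intro R _ _
  refine ⟨fun g hg => hg.1, fun g hg => ((mem_reductivePoints_iff hm).1 hg).1,
    fun g hg n hn => conj_mem_unipotentPoints hm hg hn, unipotentPoints_inf_reductivePoints hm,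
    fun g hg => ?_⟩
  obtain ⟨n, hn, x, rfl⟩ := exists_mul_eq hm hg
  exact ⟨n, hn, _, ⟨x, rfl⟩, rfl⟩

/-! ### Connectedness for the Zariski topology -/

section Zariski

variable {ι : Type} [Fintype ι] [DecidableEq ι]

theorem isTopologicalBasis_zariski (K : Type u) [Field K] :
    @TopologicalSpace.IsTopologicalBasis (GL ι K) (zariskiTopology ι K)
      {U | ∃ p : MvPolynomial (ι × ι) K,
        U = {g : GL ι K | MvPolynomial.eval (fun ij : ι × ι => g.val ij.1 ij.2) p ≠ 0}} := by
  let _ := zariskiTopology ι K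
  refine ⟨?_, ?_, rfl⟩
  · rintro _ ⟨p, rfl⟩ _ ⟨q, rfl⟩ g hg
    refine ⟨_, ⟨p * q, rfl⟩, ?_, ?_⟩
    · simpa using hg
    · intro h hh
      simpa using hh
  · refine Set.eq_univ_of_univ_subset fun g _ => ?_
    exact ⟨_, ⟨1, rfl⟩, by simp⟩

/-- The set is the image of an open part of the affine line, and nonempty open subsets of the line
over an infinite field meet. -/
theorem isPreirreducible_polynomialCurve {K : Type u} [Field K] [Infinite K]
    (F : Matrix ι ι (Polynomial K)) :
    @IsPreirreducible (GL ι K) (zariskiTopology ι K)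
      {g | ∃ s : K, g.val = F.map (Polynomial.eval s)} := by
  let _ := zariskiTopology ι K
  have key : ∀ (p : MvPolynomial (ι × ι) K) (s : K),
      MvPolynomial.eval (fun ij : ι × ι => F.map (Polynomial.eval s) ij.1 ij.2) p =
        Polynomial.eval s (MvPolynomial.aeval (fun ij : ι × ι => F ij.1 ij.2) p) := by
    intro p s
    rw [← Polynomial.coe_evalRingHom, MvPolynomial.aeval_def, MvPolynomial.hom_eval₂]
    have : (Polynomial.evalRingHom s).comp (algebraMap K (Polynomial K)) = RingHom.id K := by
      ext x; simp
    rw [this]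
    rfl
  rintro U V hU hV ⟨g, ⟨s, hs⟩, hgU⟩ ⟨h, ⟨t, ht⟩, hhV⟩
  obtain ⟨_, ⟨p, rfl⟩, hgp, hpU⟩ := (isTopologicalBasis_zariski K).exists_subset_of_mem_open hgU hU
  obtain ⟨_, ⟨q, rfl⟩, hhq, hqV⟩ := (isTopologicalBasis_zariski K).exists_subset_of_mem_open hhV hV
  rw [Set.mem_ofPred_eq, hs, key] at hgp
  rw [Set.mem_ofPred_eq, ht, key] at hhq
  have hdet : ∀ s, (F.map (Polynomial.eval s)).det = Polynomial.eval s F.det := fun s =>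
    (RingHom.map_det (Polynomial.evalRingHom s) F).symm
  have hd : F.det ≠ 0 := by
    intro h0
    have := hdet s
    rw [h0, Polynomial.eval_zero, ← hs] at this
    exact ((Matrix.isUnit_iff_isUnit_det _).1 g.isUnit).ne_zero this
  set P := MvPolynomial.aeval (fun ij : ι × ι => F ij.1 ij.2) p with hP
  set Q := MvPolynomial.aeval (fun ij : ι × ι => F ij.1 ij.2) q with hQ
  -- A non-root of this product is a parameter at which the curve is invertible and lies in both
  -- basic open sets.
  have hne : P * Q * F.det ≠ 0 := by
    refine mul_ne_zero (mul_ne_zero ?_ ?_) hd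
    · rintro h0; simp [h0] at hgp
    · rintro h0; simp [h0] at hhq
  obtain ⟨r, hr⟩ : ∃ r, Polynomial.eval r (P * Q * F.det) ≠ 0 := by
    by_contra! hcon
    exact hne (Polynomial.funext fun r => by simpa using hcon r)
  simp only [Polynomial.eval_mul, mul_ne_zero_iff] at hr
  refine ⟨Matrix.GeneralLinearGroup.mkOfDetNeZero (F.map (Polynomial.eval r))
    (by rw [hdet]; exact hr.2), ⟨r, rfl⟩, hpU ?_, hqV ?_⟩
  · change MvPolynomial.eval (fun ij : ι × ι => F.map (Polynomial.eval r) ij.1 ij.2) p ≠ 0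
    rw [key]; exact hr.1.1
  · change MvPolynomial.eval (fun ij : ι × ι => F.map (Polynomial.eval r) ij.1 ij.2) q ≠ 0
    rw [key]; exact hr.1.2

/-- Only the invertible values of F are required to lie in G, so curves may pass through singular
matrices. -/
theorem isConnected_of_polynomialCurve {K : Type u} [Field K] [Infinite K] (G : Subgroup (GL ι K))
    (h : ∀ g ∈ G, ∃ F : Matrix ι ι (Polynomial K),
      (∀ x : GL ι K, (∃ s : K, x.val = F.map (Polynomial.eval s)) → x ∈ G) ∧
      (∃ s : K, 1 = F.map (Polynomial.eval s)) ∧ ∃ s : K, g.val = F.map (Polynomial.eval s)) :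
    @IsConnected (GL ι K) (zariskiTopology ι K) (G : Set (GL ι K)) := by
  let _ := zariskiTopology ι K
  refine ⟨⟨1, one_mem G⟩, isPreconnected_of_forall 1 fun g hg => ?_⟩
  obtain ⟨F, hF, h1, h2⟩ := h g hg
  exact ⟨_, fun x hx => hF x hx, h1, h2, (isPreirreducible_polynomialCurve F).isPreconnected⟩

theorem AlgSubgroup.isClosed_pts (G : AlgSubgroup.{u} ι) (K : Type u) [Field K] [Algebra ℚ K] :
    @IsClosed (GL ι K) (zariskiTopology ι K) (G.pts K : Set (GL ι K)) := by
  let _ := zariskiTopology ι K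
  obtain ⟨S, hS⟩ := G.exists_equations
  have : (G.pts K : Set (GL ι K)) = ⋂ p ∈ S, {g : GL ι K |
      MvPolynomial.eval (fun ij : ι × ι => g.val ij.1 ij.2)
        (MvPolynomial.map (algebraMap ℚ K) p) ≠ 0}ᶜ := by
    ext g
    simp [hS, MvPolynomial.eval_map, MvPolynomial.aeval_def]
  rw [this]
  refine isClosed_biInter fun p _ => ?_
  rw [isClosed_compl_iff]
  exact TopologicalSpace.isOpen_generateFrom_of_mem ⟨_, rfl⟩

end Zariski

/-! ### Polynomial curves joining automorphisms to the identity -/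

section Curves

variable {m : ℕ} {K : Type u} [Field K]

/-- The contraction of a block unitriangular matrix to the identity. -/
noncomputable def contraction (n : Matrix ((Fin m × Fin 2) ⊕ Fin 2) ((Fin m × Fin 2) ⊕ Fin 2) K) :
    Matrix ((Fin m × Fin 2) ⊕ Fin 2) ((Fin m × Fin 2) ⊕ Fin 2) (Polynomial K) :=
  Matrix.of fun p q =>
    Polynomial.C (n p q) * Polynomial.X ^ (basisDegree m q - basisDegree m p)

/-- A one-parameter torus of H that realises the grading, shifted by 2. -/
theorem reductiveMatrix_scalar (hm : 1 ≤ m) (s : Kˣ) :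
    reductiveMatrix m ((s : K) ^ (m + 1) • (1 : Matrix (Fin 2) (Fin 2) K)) ((s⁻¹ : Kˣ) : K) =
      Matrix.diagonal fun p => (s : K) ^ (basisDegree m p + 2) := by
  have hs : (s : K) ≠ 0 := s.ne_zero
  ext (p | a) (q | b)
  · rw [reductiveMatrix_inl_inl, Matrix.diagonal_apply]
    obtain ⟨i, c⟩ := p
    obtain ⟨j, d⟩ := q
    by_cases hij : i = j
    · subst hij
      by_cases hcd : c = d
      · subst hcd
        have : m + 1 = (m - 1 - (i : ℕ)) + (i + 2) := by omega
        simp only [if_true, Matrix.smul_apply, Matrix.one_apply_eq, smul_eq_mul, mul_one,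
          basisDegree, Sum.elim_inl, Units.val_inv_eq_inv_val]
        rw [this, pow_add, ← mul_assoc, ← mul_pow, inv_mul_cancel₀ hs, one_pow, one_mul]
      · simp [hcd]
    · simp [hij]
  · rfl
  · rfl
  · rw [reductiveMatrix_inr_inr, Matrix.diagonal_apply]
    have e1 : (s : K) ^ (2 * (m + 1)) = s ^ m * s ^ (m + 2) := by rw [← pow_add]; congr 1; omega
    have e2 : (s : K) ^ (2 * (m + 1)) = s ^ (m - 1) * s ^ (m + 1 + 2) := by
      rw [← pow_add]; congr 1; omega
    have e3 : ((s : K) ^ (m + 1) • (1 : Matrix (Fin 2) (Fin 2) K)).det = s ^ (2 * (m + 1)) := by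
      rw [Matrix.det_smul, Matrix.det_one, mul_one, ← pow_mul, mul_comm]; simp
    rw [e3]
    fin_cases a <;> fin_cases b
    · simp [basisDegree, e1]
    · simp
    · simp
    · simp [basisDegree, e2]

/-- For s ≠ 0 the contraction is conjugation by the grading torus, which preserves N; at s = 0 it is
the identity, since the nontrivial entries of n have positive degree. -/
theorem exists_contraction_eq [Algebra ℚ K] (hm : 1 ≤ m) {n : GL ((Fin m × Fin 2) ⊕ Fin 2) K}
    (hn : n ∈ unipotentPoints m K hm) (s : K) :
    ∃ n' ∈ unipotentPoints m K hm, n'.val = (contraction n.val).map (Polynomial.eval s) := by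
  have hval : ∀ p q, (contraction n.val).map (Polynomial.eval s) p q =
      n.val p q * s ^ (basisDegree m q - basisDegree m p) := by
    intro p q; simp [contraction]
  have hdeg : ∀ p q, basisDegree m q ≤ basisDegree m p →
      n.val p q = (1 : Matrix _ _ K) p q := fun p q h => sub_eq_zero.1 (hn.2 p q h)
  by_cases hs : s = 0
  · refine ⟨1, one_mem _, Matrix.ext fun p q => ?_⟩
    rw [hval]
    rcases le_or_gt (basisDegree m q) (basisDegree m p) with h | h
    · rw [hdeg p q h, Nat.sub_eq_zero_of_le h, pow_zero, mul_one]; rfl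
    · rw [hs, zero_pow (by omega), mul_zero]
      exact Matrix.one_apply_ne (by rintro rfl; exact lt_irrefl _ h)
  · let σ : Kˣ := Units.mk0 s hs
    let A : GL (Fin 2) K := ⟨s ^ (m + 1) • 1, (s ^ (m + 1))⁻¹ • 1,
      by simp [smul_smul, hs], by simp [smul_smul, hs]⟩
    set D := reductiveHom m K (A, σ⁻¹) with hD
    have hDval : D.val = Matrix.diagonal fun p => s ^ (basisDegree m p + 2) :=
      reductiveMatrix_scalar hm σ
    refine ⟨D⁻¹ * n * D⁻¹⁻¹,
      conj_mem_unipotentPoints hm (inv_mem (reductiveHom_mem_autGroup m _)) hn, ?_⟩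
    have h1 : D.val * (contraction n.val).map (Polynomial.eval s) = n.val * D.val := by
      ext p q
      rw [hDval, Matrix.diagonal_mul, Matrix.mul_diagonal, hval]
      rcases le_or_gt (basisDegree m q) (basisDegree m p) with h | h
      · rw [hdeg p q h]
        by_cases hpq : p = q
        · subst hpq; simp
        · simp [Matrix.one_apply_ne hpq]
      · have : basisDegree m q + 2 =
            basisDegree m p + 2 + (basisDegree m q - basisDegree m p) := by omega
        rw [this, pow_add]
        ring
    rw [inv_inv, Units.val_mul, Units.val_mul, mul_assoc, ← h1, ← mul_assoc, ← Units.val_mul]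
    simp

theorem contraction_eval_one (n : Matrix ((Fin m × Fin 2) ⊕ Fin 2) ((Fin m × Fin 2) ⊕ Fin 2) K) :
    (contraction n).map (Polynomial.eval 1) = n := by
  ext p q; simp [contraction]

theorem contraction_eval_zero [Algebra ℚ K] (hm : 1 ≤ m) {n : GL ((Fin m × Fin 2) ⊕ Fin 2) K}
    (hn : n ∈ unipotentPoints m K hm) : (contraction n.val).map (Polynomial.eval 0) = 1 := by
  ext p q
  have hdeg : ∀ p q, basisDegree m q ≤ basisDegree m p →
      n.val p q = (1 : Matrix _ _ K) p q := fun p q h => sub_eq_zero.1 (hn.2 p q h)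
  rw [Matrix.map_apply, contraction, Matrix.of_apply]
  rcases le_or_gt (basisDegree m q) (basisDegree m p) with h | h
  · rw [hdeg p q h, Nat.sub_eq_zero_of_le h]; simp
  · rw [Matrix.one_apply_ne (by rintro rfl; exact lt_irrefl _ h)]
    simp [Nat.sub_ne_zero_of_lt h]

/-- The line from the identity to a block diagonal automorphism. -/
noncomputable def reductiveLine (m : ℕ) {K : Type u} [Field K] (A : Matrix (Fin 2) (Fin 2) K)
    (μ : K) : Matrix ((Fin m × Fin 2) ⊕ Fin 2) ((Fin m × Fin 2) ⊕ Fin 2) (Polynomial K) :=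
  reductiveMatrix m (Matrix.of fun i j => Polynomial.C ((1 : Matrix (Fin 2) (Fin 2) K) i j) +
    Polynomial.X * Polynomial.C ((A - 1) i j)) (1 + Polynomial.X * Polynomial.C (μ - 1))

theorem reductiveLine_eval (A : Matrix (Fin 2) (Fin 2) K) (μ s : K) :
    (reductiveLine m A μ).map (Polynomial.eval s) =
      reductiveMatrix m (1 + s • (A - 1)) (1 + s * (μ - 1)) := by
  rw [reductiveLine, ← Polynomial.coe_evalRingHom, map_reductiveMatrix]
  congr 1
  · ext i j; simp
  · simp

theorem reductiveMatrix_one : reductiveMatrix m (1 : Matrix (Fin 2) (Fin 2) K) 1 = 1 :=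
  map_one (reductiveMatrixHom m)

/-- The diagonal entry μ^m det A at f must be nonzero, and m ≥ 1, so both A and μ are invertible. -/
theorem exists_reductiveHom_val_eq (hm : 1 ≤ m) {A : Matrix (Fin 2) (Fin 2) K} {μ : K}
    (h : (reductiveMatrix m A μ).det ≠ 0) :
    ∃ x, (reductiveHom m K x).val = reductiveMatrix m A μ := by
  have h0 : μ ^ m * A.det ≠ 0 := by
    intro h0
    refine h (Matrix.det_eq_zero_of_row_eq_zero (Sum.inr 0) ?_)
    rintro (q | b)
    · rfl
    · rw [reductiveMatrix_inr_inr]; simp [h0]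
  have hμ : μ ≠ 0 := by
    rintro rfl
    rw [zero_pow (by omega), zero_mul] at h0
    exact h0 rfl
  exact ⟨(Matrix.GeneralLinearGroup.mkOfDetNeZero A (right_ne_zero_of_mul h0), Units.mk0 μ hμ), rfl⟩

theorem isConnected_unipotentPoints [Algebra ℚ K] [Infinite K] (hm : 1 ≤ m) :
    @IsConnected (GL ((Fin m × Fin 2) ⊕ Fin 2) K) (zariskiTopology _ K) (unipotentPoints m K hm :
      Set (GL ((Fin m × Fin 2) ⊕ Fin 2) K)) := by
  refine isConnected_of_polynomialCurve _ fun n hn => ⟨contraction n.val, ?_,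
    ⟨0, (contraction_eval_zero hm hn).symm⟩, ⟨1, (contraction_eval_one _).symm⟩⟩
  rintro x ⟨s, hs⟩
  obtain ⟨n', hn', h⟩ := exists_contraction_eq hm hn s
  rwa [Units.ext (hs.trans h.symm)]

theorem isConnected_reductivePoints [Algebra ℚ K] [Infinite K] (hm : 1 ≤ m) :
    @IsConnected (GL ((Fin m × Fin 2) ⊕ Fin 2) K) (zariskiTopology _ K) (reductivePoints m K :
      Set (GL ((Fin m × Fin 2) ⊕ Fin 2) K)) := by
  refine isConnected_of_polynomialCurve _ ?_
  rintro _ ⟨⟨A, μ⟩, rfl⟩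
  refine ⟨reductiveLine m A.val μ, ?_, ⟨0, ?_⟩, ⟨1, ?_⟩⟩
  · rintro x ⟨s, hs⟩
    rw [reductiveLine_eval] at hs
    obtain ⟨y, hy⟩ := exists_reductiveHom_val_eq hm
      (hs ▸ ((Matrix.isUnit_iff_isUnit_det _).1 x.isUnit).ne_zero)
    exact ⟨y, Units.ext (hy.trans hs.symm)⟩
  · rw [reductiveLine_eval]
    simp [reductiveMatrix_one]
  · rw [reductiveLine_eval, reductiveHom_val]; simp

/-- For g = n h, the contraction of n is multiplied by the segment from 1 to h. -/
theorem isConnected_autGroup [Algebra ℚ K] [Infinite K] (hm : 1 ≤ m) :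
    @IsConnected (GL ((Fin m × Fin 2) ⊕ Fin 2) K) (zariskiTopology _ K) (autGroup m K :
      Set (GL ((Fin m × Fin 2) ⊕ Fin 2) K)) := by
  refine isConnected_of_polynomialCurve _ fun g hg => ?_
  obtain ⟨n, hn, ⟨A, μ⟩, rfl⟩ := exists_mul_eq hm hg
  have hmap : ∀ s : K, (contraction n.val * reductiveLine m A.val (μ : K)).map (Polynomial.eval s) =
      (contraction n.val).map (Polynomial.eval s) *
        reductiveMatrix m (1 + s • (A.val - 1)) (1 + s * ((μ : K) - 1)) := by
    intro s
    rw [← reductiveLine_eval, ← Polynomial.coe_evalRingHom, Matrix.map_mul]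
  refine ⟨contraction n.val * reductiveLine m A.val μ, ?_, ⟨0, ?_⟩, ⟨1, ?_⟩⟩
  · rintro x ⟨s, hs⟩
    obtain ⟨n', hn', h⟩ := exists_contraction_eq hm hn s
    rw [hmap, ← h] at hs
    have hx := ((Matrix.isUnit_iff_isUnit_det _).1 x.isUnit).ne_zero
    rw [hs, Matrix.det_mul] at hx
    obtain ⟨y, hy⟩ := exists_reductiveHom_val_eq hm (right_ne_zero_of_mul hx)
    rw [← hy, ← Units.val_mul] at hs
    rw [Units.ext hs]
    exact mul_mem hn'.1 (reductiveHom_mem_autGroup m y)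
  · rw [hmap, contraction_eval_zero hm hn]
    simp [reductiveMatrix_one]
  · rw [hmap, contraction_eval_one, Units.val_mul, reductiveHom_val]; simp

end Curves

/-! ### Normal unipotent subgroups -/

/-- The rows indexed by κ are supported on κ, so they span an invariant subspace for the action on
row vectors. -/
theorem Matrix.pow_apply_of_invariant {ι κ R : Type*} [Fintype ι] [DecidableEq ι] [Fintype κ]
    [DecidableEq κ] [CommRing R] {M : Matrix ι ι R} {N : Matrix κ κ R} (f : κ ↪ ι)
    (h : ∀ a b, M (f a) (f b) = N a b) (h' : ∀ a q, q ∉ Set.range f → M (f a) q = 0) (n : ℕ)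
    (a b : κ) : (M ^ n) (f a) (f b) = (N ^ n) a b := by
  induction n generalizing a with
  | zero => simp [Matrix.one_apply]
  | succ n ih =>
    rw [pow_succ', pow_succ', Matrix.mul_apply, Matrix.mul_apply]
    rw [← Finset.sum_subset (Finset.subset_univ (Finset.univ.map f))]
    · rw [Finset.sum_map]
      exact Finset.sum_congr rfl fun c _ => by rw [h, ih]
    · intro q _ hq
      rw [h' a q (by simpa using hq), zero_mul]

section Radical

variable {m : ℕ} {K : Type u} [Field K]

theorem IsStrictlyTriangular.reductiveHom_mul {g h : GL ((Fin m × Fin 2) ⊕ Fin 2) K}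
    {x y : GL (Fin 2) K × Kˣ}
    (hg : IsStrictlyTriangular (basisDegree m) (g.val - (reductiveHom m K x).val))
    (hh : IsStrictlyTriangular (basisDegree m) (h.val - (reductiveHom m K y).val)) :
    IsStrictlyTriangular (basisDegree m) ((g * h).val - (reductiveHom m K (x * y)).val) := by
  have hy : (reductiveHom m K y).val.BlockTriangular (basisDegree m) :=
    (isHomogeneous_reductiveMatrix m _ _).blockTriangular
  have hx : (reductiveHom m K x).val.BlockTriangular (basisDegree m) :=
    (isHomogeneous_reductiveMatrix m _ _).blockTriangular
  have hh' : h.val.BlockTriangular (basisDegree m) := by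
    have := hh.blockTriangular.add hy
    rwa [sub_add_cancel] at this
  have : (g * h).val - (reductiveHom m K (x * y)).val =
      (g.val - (reductiveHom m K x).val) * h.val +
        (reductiveHom m K x).val * (h.val - (reductiveHom m K y).val) := by
    rw [map_mul, Units.val_mul, Units.val_mul]; noncomm_ring
  rw [this]
  exact (hg.mul_right hh').add (hh.mul_left hx)

/-- Unipotence passes to the associated graded matrix. -/
theorem isNilpotent_reductiveHom_sub_one {g : GL ((Fin m × Fin 2) ⊕ Fin 2) K}
    {x : GL (Fin 2) K × Kˣ}
    (hg : IsStrictlyTriangular (basisDegree m) (g.val - (reductiveHom m K x).val))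
    (hn : IsNilpotent (g.val - 1)) : IsNilpotent ((reductiveHom m K x).val - 1) := by
  obtain ⟨n, hn⟩ := hn
  have hx : IsHomogeneous (basisDegree m) ((reductiveHom m K x).val - 1) :=
    (isHomogeneous_reductiveMatrix m _ _).sub isHomogeneous_one
  have h : IsStrictlyTriangular (basisDegree m)
      ((g.val - 1) - ((reductiveHom m K x).val - 1)) := by rwa [sub_sub_sub_cancel_right]
  have := (h.pow_sub_pow hx.blockTriangular n).neg
  rw [hn, zero_sub, neg_neg] at this
  exact ⟨n, (hx.pow n).eq_zero this⟩

/-- The last block, where μ has exponent 0, shows that A is unipotent. The two central scalars equal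
1, and they differ by the factor μ. -/
theorem trace_det_of_isNilpotent (hm : 1 ≤ m) {A : GL (Fin 2) K} {μ : Kˣ}
    (h : IsNilpotent ((reductiveHom m K (A, μ)).val - 1)) :
    A.val.trace = 2 ∧ A.val.det = 1 ∧ μ = 1 := by
  obtain ⟨n, hn⟩ := h
  rw [reductiveHom_val] at hn
  set M := reductiveMatrix m A.val (μ : K) - 1 with hM
  have hA : (A.val - 1) ^ n = 0 := by
    let f : Fin 2 ↪ (Fin m × Fin 2) ⊕ Fin 2 :=
      ⟨fun a => Sum.inl (⟨m - 1, by omega⟩, a), fun a b h => by simpa using h⟩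
    ext a b
    rw [← Matrix.pow_apply_of_invariant (M := M) f ?_ ?_, hn]
    · rfl
    · intro a b
      change M (Sum.inl _) (Sum.inl _) = _
      rw [hM, Matrix.sub_apply, reductiveMatrix_inl_inl]
      simp [Matrix.one_apply]
    · rintro a (⟨i, b⟩ | b) hq
      · have hi : (⟨m - 1, by omega⟩ : Fin m) ≠ i := by
          rintro rfl
          exact hq ⟨b, rfl⟩
        change M (Sum.inl _) (Sum.inl _) = _
        rw [hM, Matrix.sub_apply, reductiveMatrix_inl_inl, if_neg hi]
        simp [hi]
      · change M (Sum.inl _) (Sum.inr _) = _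
        simp [hM, reductiveMatrix]
  have hB : ∀ a, ![(μ : K) ^ m * A.val.det, (μ : K) ^ (m - 1) * A.val.det] a = 1 := by
    intro a
    have h1 := Matrix.pow_apply_of_invariant (M := M) (N := Matrix.diagonal fun a =>
      ![(μ : K) ^ m * A.val.det, (μ : K) ^ (m - 1) * A.val.det] a - 1)
      (Function.Embedding.inr : Fin 2 ↪ (Fin m × Fin 2) ⊕ Fin 2) ?_ ?_ n a a
    · rw [hn, Matrix.diagonal_pow, Matrix.diagonal_apply_eq] at h1
      exact sub_eq_zero.1 (eq_zero_of_pow_eq_zero h1.symm)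
    · intro a b
      change M (Sum.inr _) (Sum.inr _) = _
      rw [hM, Matrix.sub_apply, reductiveMatrix_inr_inr, Matrix.diagonal_apply, Matrix.one_apply]
      by_cases hab : a = b <;> simp [hab]
    · rintro a (q | b) hq
      · change M (Sum.inr _) (Sum.inl _) = _
        simp [hM, reductiveMatrix]
      · exact (hq ⟨b, rfl⟩).elim
  have e0 : (μ : K) ^ m * A.val.det = 1 := hB 0
  have e1 : (μ : K) ^ (m - 1) * A.val.det = 1 := hB 1
  have hμ : (μ : K) = 1 := by
    have hm' : m = m - 1 + 1 := by omega
    rw [hm', pow_succ] at e0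
    linear_combination e0 - (μ : K) * e1
  refine ⟨?_, ?_, Units.ext hμ⟩
  · have := (Matrix.isNilpotent_trace_of_isNilpotent ⟨n, hA⟩).eq_zero
    rw [Matrix.trace_sub, Matrix.trace_one, sub_eq_zero] at this
    simpa using this
  · simpa [hμ] using e0

/-- Only conjugation by H is assumed, so the lemma serves both for the radical of the automorphism
group and for the reductivity of H. -/
theorem le_unipotentPoints [Algebra ℚ K] (hm : 1 ≤ m)
    {U : Subgroup (GL ((Fin m × Fin 2) ⊕ Fin 2) K)} (hU : U ≤ autGroup m K)
    (hconj : ∀ h ∈ reductivePoints m K, ∀ u ∈ U, h * u * h⁻¹ ∈ U) (hunip : IsUnipotentSubgroup U) :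
    U ≤ unipotentPoints m K hm := by
  intro g hg
  obtain ⟨⟨A, μ⟩, hx⟩ := exists_reductiveHom_sub_strict hm (hU hg)
  obtain ⟨htr, hdet, rfl⟩ := trace_det_of_isNilpotent hm
    (isNilpotent_reductiveHom_sub_one hx (hunip g hg))
  -- The product of a conjugate of g with g is again in U, hence unipotent.
  have key : ∀ P : GL (Fin 2) K, (P.val * A.val * (P⁻¹).val * A.val).trace = 2 := by
    intro P
    have hP : ∀ x, IsStrictlyTriangular (basisDegree m)
        ((reductiveHom m K x).val - (reductiveHom m K x).val) := fun x p q _ => by simp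
    have h1 := (((hP (P, 1)).reductiveHom_mul hx).reductiveHom_mul
      (hP (P, 1)⁻¹)).reductiveHom_mul hx
    rw [map_inv] at h1
    exact (trace_det_of_isNilpotent hm (isNilpotent_reductiveHom_sub_one h1
      (hunip _ (mul_mem (hconj _ ⟨_, rfl⟩ g hg) hg)))).1
  -- For this P the trace is tr(A²) minus the square of the lower left entry, and tr(A²) = (tr A)² -
  -- 2 det A = 2. The transposed P treats the upper right entry.
  have h1 := key ⟨!![1, 1; 0, 1], !![1, -1; 0, 1], by ext i j; fin_cases i <;> fin_cases j <;> simp,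
    by ext i j; fin_cases i <;> fin_cases j <;> simp⟩
  have h2 := key ⟨!![1, 0; 1, 1], !![1, 0; -1, 1], by ext i j; fin_cases i <;> fin_cases j <;> simp,
    by ext i j; fin_cases i <;> fin_cases j <;> simp⟩
  rw [Units.inv_mk] at h1 h2
  simp only [Matrix.trace_fin_two, Matrix.mul_apply, Fin.sum_univ_two, Matrix.of_apply,
    Matrix.cons_val_zero, Matrix.cons_val_one, Matrix.cons_val'] at h1 h2 htr
  rw [Matrix.det_fin_two] at hdet
  have e10 : A.val 1 0 = 0 := by
    refine pow_eq_zero_iff two_ne_zero |>.1 ?_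
    linear_combination -h1 + (A.val 0 0 + A.val 1 1 + 2) * htr - 2 * hdet
  have e01 : A.val 0 1 = 0 := by
    refine pow_eq_zero_iff two_ne_zero |>.1 ?_
    linear_combination -h2 + (A.val 0 0 + A.val 1 1 + 2) * htr - 2 * hdet
  have e00 : A.val 0 0 = 1 := by
    refine sub_eq_zero.1 (pow_eq_zero_iff two_ne_zero |>.1 ?_)
    linear_combination A.val 0 0 * htr - hdet - A.val 0 1 * e10
  have hA : A = 1 := by
    refine Units.ext (Matrix.ext fun i j => ?_)
    fin_cases i <;> fin_cases j
    · simpa using e00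
    · simpa using e01
    · simpa using e10
    · have : A.val 1 1 = 1 := by linear_combination htr - e00
      simpa using this
  rw [hA] at hx
  have h3 : ((1 : GL (Fin 2) K), (1 : Kˣ)) = 1 := rfl
  rw [h3, map_one] at hx
  exact ⟨hU hg, hx⟩

end Radical

theorem isUnipotentRadical_autGroup (m : ℕ) (hm : 1 ≤ m) :
    AlgSubgroup.IsUnipotentRadical
      (algebraicAutGroup.{u} (DStarLieAlgebra.basisC m (Polynomial.X ^ m)))
      (unipotentGroup m hm) := by
  refine ⟨fun R _ _ => ⟨fun g hg => hg.1, fun g hg n hn => conj_mem_unipotentPoints hm hg hn⟩,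
    fun K _ _ _ => ⟨?_, fun U hU => le_unipotentPoints hm hU.le
      (fun h hh u hu => hU.normal h ((mem_reductivePoints_iff hm).1 hh).1 u hu) hU.unipotent⟩⟩
  exact ⟨fun g hg => hg.1, fun g hg n hn => conj_mem_unipotentPoints hm hg hn,
    (unipotentGroup m hm).isClosed_pts K, isConnected_unipotentPoints hm,
    fun g hg => hg.2.isNilpotent⟩

/-- A normal unipotent subgroup of H lies in N by `le_unipotentPoints`, and N meets H trivially. -/
theorem isReductive_reductiveGroup (m : ℕ) (hm : 1 ≤ m) :
    AlgSubgroup.IsReductive (reductiveGroup.{u} m hm) := by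
  intro K _ _ _
  refine ⟨isConnected_reductivePoints hm, fun U hU => ?_⟩
  have h := le_unipotentPoints hm (fun g hg => ((mem_reductivePoints_iff hm).1 (hU.le hg)).1)
    hU.normal hU.unipotent
  exact eq_bot_iff.2 ((le_inf h hU.le).trans (unipotentPoints_inf_reductivePoints hm).le)

theorem isIdentityComponent_autGroup (m : ℕ) (hm : 1 ≤ m) :
    AlgSubgroup.IsIdentityComponent
      (algebraicAutGroup.{u} (DStarLieAlgebra.basisC m (Polynomial.X ^ m)))
      (algebraicAutGroup (DStarLieAlgebra.basisC m (Polynomial.X ^ m))) := by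
  intro K _ _ _
  let _ := zariskiTopology ((Fin m × Fin 2) ⊕ Fin 2) K
  exact (IsPreconnected.connectedComponentIn (isConnected_autGroup hm).isPreconnected
    (one_mem (autGroup m K))).symm

/-! ### Exponentials of nilpotent derivations -/

section Exp

variable {ι κ : Type*} [Fintype ι] [DecidableEq ι] [Fintype κ] [DecidableEq κ]
  {k : Type*} [Field k]

theorem Matrix.kronecker_one_pow (D : Matrix ι ι k) (n : ℕ) :
    (D ⊗ₖ (1 : Matrix ι ι k)) ^ n = (D ^ n) ⊗ₖ (1 : Matrix ι ι k) := by
  induction n with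
  | zero => simp
  | succ n ih => rw [_root_.pow_succ, ih, ← Matrix.mul_kronecker_mul, one_mul, _root_.pow_succ]

theorem Matrix.one_kronecker_pow (D : Matrix ι ι k) (n : ℕ) :
    ((1 : Matrix ι ι k) ⊗ₖ D) ^ n = (1 : Matrix ι ι k) ⊗ₖ (D ^ n) := by
  induction n with
  | zero => simp
  | succ n ih => rw [_root_.pow_succ, ih, ← Matrix.mul_kronecker_mul, one_mul, _root_.pow_succ]

theorem Matrix.commute_kronecker_one_one_kronecker (D : Matrix ι ι k) :
    Commute (D ⊗ₖ (1 : Matrix ι ι k)) ((1 : Matrix ι ι k) ⊗ₖ D) := by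
  rw [Commute, SemiconjBy, ← Matrix.mul_kronecker_mul, ← Matrix.mul_kronecker_mul]
  simp

theorem IsNilpotent.kronecker_one {D : Matrix ι ι k} (hD : IsNilpotent D) :
    IsNilpotent (D ⊗ₖ (1 : Matrix ι ι k)) := by
  obtain ⟨N, hN⟩ := hD
  exact ⟨N, by rw [Matrix.kronecker_one_pow, hN, Matrix.zero_kronecker]⟩

theorem IsNilpotent.one_kronecker {D : Matrix ι ι k} (hD : IsNilpotent D) :
    IsNilpotent ((1 : Matrix ι ι k) ⊗ₖ D) := by
  obtain ⟨N, hN⟩ := hD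
  exact ⟨N, by rw [Matrix.one_kronecker_pow, hN, Matrix.kronecker_zero]⟩

variable [Algebra ℚ k]

theorem IsNilpotent.exp_mul_eq_mul_exp {A : Matrix ι ι k} {D : Matrix κ κ k} {β : Matrix ι κ k}
    (hA : IsNilpotent A) (hD : IsNilpotent D) (h : A * β = β * D) :
    IsNilpotent.exp A * β = β * IsNilpotent.exp D := by
  obtain ⟨a, ha⟩ := hA
  obtain ⟨d, hd⟩ := hD
  have hpow : ∀ n, A ^ n * β = β * D ^ n := by
    intro n
    induction n with
    | zero => simp
    | succ n ih =>
      rw [pow_succ', Matrix.mul_assoc, ih, ← Matrix.mul_assoc, h, Matrix.mul_assoc, ← pow_succ']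
  rw [IsNilpotent.exp_eq_sum (pow_eq_zero_of_le (le_max_left a d) ha),
    IsNilpotent.exp_eq_sum (pow_eq_zero_of_le (le_max_right a d) hd), Matrix.sum_mul,
    Matrix.mul_sum]
  exact Finset.sum_congr rfl fun n _ => by rw [Matrix.smul_mul, Matrix.mul_smul, hpow]

/-- The exponent is the action of D on the tensor square by the Leibniz rule; its two summands
commute. -/
theorem IsNilpotent.exp_kronecker_exp {D : Matrix ι ι k} (hD : IsNilpotent D) :
    IsNilpotent.exp D ⊗ₖ IsNilpotent.exp D =
      IsNilpotent.exp (D ⊗ₖ (1 : Matrix ι ι k) + (1 : Matrix ι ι k) ⊗ₖ D) := by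
  rw [IsNilpotent.exp_add_of_commute (Matrix.commute_kronecker_one_one_kronecker D)
    hD.kronecker_one hD.one_kronecker]
  obtain ⟨N, hN⟩ := hD
  have e1 : IsNilpotent.exp (D ⊗ₖ (1 : Matrix ι ι k)) =
      IsNilpotent.exp D ⊗ₖ (1 : Matrix ι ι k) := by
    rw [IsNilpotent.exp_eq_sum (k := N) (by rw [Matrix.kronecker_one_pow, hN, Matrix.zero_kronecker]),
      IsNilpotent.exp_eq_sum hN]
    ext ⟨i, j⟩ ⟨i', j'⟩
    simp only [Matrix.sum_apply, Matrix.kroneckerMap_apply, Matrix.kronecker_one_pow,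
      Matrix.smul_apply, Finset.sum_mul, smul_mul_assoc]
  have e2 : IsNilpotent.exp ((1 : Matrix ι ι k) ⊗ₖ D) =
      (1 : Matrix ι ι k) ⊗ₖ IsNilpotent.exp D := by
    rw [IsNilpotent.exp_eq_sum (k := N) (by rw [Matrix.one_kronecker_pow, hN, Matrix.kronecker_zero]),
      IsNilpotent.exp_eq_sum hN]
    ext ⟨i, j⟩ ⟨i', j'⟩
    simp only [Matrix.sum_apply, Matrix.kroneckerMap_apply, Matrix.one_kronecker_pow,
      Matrix.smul_apply, Finset.mul_sum, mul_smul_comm]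
  rw [e1, e2, ← Matrix.mul_kronecker_mul, one_mul, mul_one]

theorem IsStrictlyTriangular.exp_sub_one {w : ι → ℕ} {D : Matrix ι ι k}
    (hD : IsStrictlyTriangular w D) : IsStrictlyTriangular w (IsNilpotent.exp D - 1) := by
  obtain ⟨N, hN⟩ := hD.isNilpotent
  intro p q hpq
  rw [IsNilpotent.exp_eq_sum (pow_eq_zero_of_le N.le_succ hN), Finset.sum_range_succ']
  simp only [pow_zero, Nat.factorial_zero, Nat.cast_one, inv_one, one_smul, add_sub_cancel_right,
    Matrix.sum_apply, Matrix.smul_apply]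
  refine Finset.sum_eq_zero fun n _ => ?_
  rw [hD.pow n.succ_ne_zero p q hpq]
  simp

end Exp

/-! ### The generators as exponentials of nilpotent derivations -/

section Derivation

variable {m : ℕ} {k : Type u} [Field k] [Algebra ℚ k]

/-- Hypothesis `hD` is the derivation property: the Gram matrices P are alternating, so S P - (S P)ᵗ
= S P + P Sᵗ. -/
theorem mem_unipotentPoints_of_exp (hm : 1 ≤ m) {g : GL ((Fin m × Fin 2) ⊕ Fin 2) k}
    {S : Matrix (Fin m × Fin 2) (Fin m × Fin 2) k} {Z : Matrix (Fin m × Fin 2) (Fin 2) k}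
    {B : Matrix (Fin 2) (Fin 2) k}
    (hs : IsStrictlyTriangular (basisDegree m) (Matrix.fromBlocks S Z 0 B))
    (hD : ∀ a, S * gramMatrix m k a - (S * gramMatrix m k a)ᵀ =
      B 0 a • gramMatrix m k 0 + B 1 a • gramMatrix m k 1)
    (hg : g.val = IsNilpotent.exp (Matrix.fromBlocks S Z 0 B)) :
    g ∈ unipotentPoints m k hm := by
  refine ⟨?_, by rw [hg]; exact hs.exp_sub_one⟩
  rw [mem_autGroup_iff_kronecker, hg, hs.isNilpotent.exp_kronecker_exp]
  have hgram : ∀ a, (gramMatrix m k a)ᵀ = -gramMatrix m k a := by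
    intro a
    ext ⟨i, c⟩ ⟨j, d⟩
    rw [Matrix.transpose_apply, Matrix.neg_apply, gramMatrix_apply, gramMatrix_apply,
      add_comm (j : ℕ)]
    split_ifs
    · fin_cases c <;> fin_cases d <;> simp [symplecticBlock]
    · simp
  have hD' : ∀ a, S * gramMatrix m k a + gramMatrix m k a * Sᵀ =
      B 0 a • gramMatrix m k 0 + B 1 a • gramMatrix m k 1 := by
    intro a
    rw [← hD, Matrix.transpose_mul, hgram, neg_mul, sub_neg_eq_add]
  refine IsNilpotent.exp_mul_eq_mul_exp ?_ hs.isNilpotent ?_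
  · exact (Matrix.commute_kronecker_one_one_kronecker _).isNilpotent_add
      hs.isNilpotent.kronecker_one hs.isNilpotent.one_kronecker
  · ext ⟨i, j⟩ l
    rw [Matrix.add_mul, Matrix.add_apply, kronecker_mul_bracketTensor_apply,
      kronecker_mul_bracketTensor_apply, bracketTensor_mul_apply, Matrix.transpose_one, mul_one,
      one_mul]
    rw [Fintype.sum_sum_type]
    rcases l with l | a
    · simp [bracketMatrix]
    · simp only [bracketMatrix, Sum.elim_inl, Sum.elim_inr, Matrix.fromBlocks_transpose,
        Matrix.fromBlocks_multiply, Matrix.fromBlocks_smul]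
      rw [← Matrix.add_apply, Matrix.fromBlocks_add]
      simp [Matrix.fromBlocks_add, hD']

theorem mul_gramMatrix_apply {R : Type*} [CommRing R]
    (M : Matrix (Fin m × Fin 2) (Fin m × Fin 2) R) (a : Fin 2)
    {j l : Fin m} (h : (l : ℕ) + j + 2 = m + a) (β : Fin 2) (p : Fin m × Fin 2) :
    (M * gramMatrix m R a) p (j, β) = if β = 0 then -M p (l, 1) else M p (l, 0) := by
  rw [Matrix.mul_apply, Fintype.sum_prod_type, Finset.sum_eq_single l]
  · fin_cases β <;> simp [gramMatrix_apply, symplecticBlock, h]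
  · intro i _ hi
    have : ¬ ((i : ℕ) + j + 2 = m + a) := fun h' => hi (Fin.ext (by omega))
    simp [gramMatrix_apply, this]
  · simp

theorem mul_gramMatrix_zero_apply {R : Type*} [CommRing R]
    (M : Matrix (Fin m × Fin 2) (Fin m × Fin 2) R)
    {j : Fin m} (h : (j : ℕ) + 1 = m) (β : Fin 2) (p : Fin m × Fin 2) :
    (M * gramMatrix m R 0) p (j, β) = 0 := by
  rw [Matrix.mul_apply]
  refine Finset.sum_eq_zero fun q _ => ?_
  have : ¬ ((q.1 : ℕ) + j + 2 = m) := by omega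
  simp [gramMatrix_apply, this]

/-- Each block column of a Gram matrix has exactly one nonzero block, except that the last pair
spans the radical of the form of f. -/
theorem exists_index (a : Fin 2) (j : Fin m) :
    (∃ l : Fin m, (l : ℕ) + j + 2 = m + a) ∨ (a = 0 ∧ (j : ℕ) + 1 = m) := by
  fin_cases a
  · by_cases h : (j : ℕ) + 1 = m
    · exact Or.inr ⟨rfl, h⟩
    · exact Or.inl ⟨⟨m - 2 - j, by omega⟩, by change (m - 2 - (j : ℕ)) + j + 2 = m + 0; omega⟩
  · exact Or.inl ⟨⟨m - 1 - j, by omega⟩, by change (m - 1 - (j : ℕ)) + j + 2 = m + 1; omega⟩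

/-- Here S P must be symmetric. Its block (i, j) is X times the symplectic block with an index
depending only on i + j, and this product is symmetric exactly when X has trace zero. -/
theorem exp_mem_of_nilpotentSet (hm : 1 ≤ m) {g : GL ((Fin m × Fin 2) ⊕ Fin 2) k}
    {M : Matrix ((Fin m × Fin 2) ⊕ Fin 2) ((Fin m × Fin 2) ⊕ Fin 2) k} (hM : M ∈ nilpotentSet m k)
    (hg : g.val = IsNilpotent.exp M) : g ∈ unipotentPoints m k hm := by
  obtain ⟨X, Z, htr, rfl⟩ := hM
  refine mem_unipotentPoints_of_exp hm ?_ ?_ hg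
  · rintro (p | a) (q | b) h
    · have h' : q.1 ≤ p.1 := h
      simp [h'.not_gt]
    · simp [basisDegree] at h
      omega
    · rfl
    · rfl
  · intro a
    have ht : ∀ d, X d 1 1 = - X d 0 0 := fun d => by
      have := htr d
      rw [Matrix.trace_fin_two] at this
      linear_combination this
    simp only [Matrix.zero_apply, zero_smul, add_zero]
    rw [sub_eq_zero]
    ext ⟨i, α⟩ ⟨j, β⟩
    rw [Matrix.transpose_apply]
    rcases exists_index a i with ⟨l', hl'⟩ | ⟨ha, hi⟩ <;>
      rcases exists_index a j with ⟨l, hl⟩ | ⟨ha', hj⟩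
    · rw [mul_gramMatrix_apply _ a hl, mul_gramMatrix_apply _ a hl']
      by_cases hil : i < l
      · have hjl : j < l' := by rw [Fin.lt_def] at *; omega
        have e : (l : ℕ) - i = l' - j := by omega
        fin_cases α <;> fin_cases β <;> simp [hil, hjl, e, ht]
      · have hjl : ¬ j < l' := by rw [Fin.lt_def] at *; omega
        fin_cases α <;> fin_cases β <;> simp [hil, hjl]
    · subst ha'
      rw [mul_gramMatrix_zero_apply _ hj, mul_gramMatrix_apply _ 0 hl']
      have hjl : ¬ j < l' := by rw [Fin.lt_def]; rw [Fin.val_zero] at hl'; omega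
      simp [hjl]
    · subst ha
      rw [mul_gramMatrix_zero_apply _ hi, mul_gramMatrix_apply _ 0 hl]
      have hil : ¬ i < l := by rw [Fin.lt_def]; omega
      simp [hil]
    · subst ha
      rw [mul_gramMatrix_zero_apply _ hi, mul_gramMatrix_zero_apply _ hj]

theorem smul_map_xiThree (t : k) : t • (xiThree m).map (algebraMap ℚ k) = Matrix.fromBlocks
    (Matrix.of fun p q : Fin m × Fin 2 =>
      if (p.1 : ℕ) + 1 = q.1 ∧ p.2 = q.2 then t * ((2 * ((p.1 : ℕ) : k) + 3 - m) / 2) else 0)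
    0 0 !![0, t; 0, 0] := by
  rw [xiThree, Matrix.fromBlocks_map, Matrix.fromBlocks_smul]
  congr 1
  · ext p q
    simp only [Matrix.smul_apply, Matrix.map_apply, Matrix.of_apply]
    split_ifs
    · simp only [smul_eq_mul, map_div₀, map_sub, map_add, map_mul, map_natCast, map_ofNat]
    · simp
  · ext; simp
  · ext; simp
  · ext i j; fin_cases i <;> fin_cases j <;> simp

theorem isStrictlyTriangular_smul_xiThree (t : k) :
    IsStrictlyTriangular (basisDegree m) (t • (xiThree m).map (algebraMap ℚ k)) := by
  rw [smul_map_xiThree]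
  rintro (p | a) (q | b) h
  · have h' : (q.1 : ℕ) ≤ p.1 := h
    have : ¬ ((p.1 : ℕ) + 1 = q.1 ∧ p.2 = q.2) := by omega
    simp [this]
  · rfl
  · rfl
  · fin_cases a <;> fin_cases b <;> simp [basisDegree] at h ⊢

theorem exp_mem_of_xiThree (hm : 1 ≤ m) {g : GL ((Fin m × Fin 2) ⊕ Fin 2) k} {t : k}
    (hg : g.val = IsNilpotent.exp (t • (xiThree m).map (algebraMap ℚ k))) :
    g ∈ unipotentPoints m k hm := by
  have hs := isStrictlyTriangular_smul_xiThree (m := m) t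
  rw [smul_map_xiThree] at hs hg
  refine mem_unipotentPoints_of_exp hm hs ?_ hg
  have : CharZero k := algebraRat.charZero k
  intro a
  ext ⟨i, α⟩ ⟨j, β⟩
  rw [Matrix.sub_apply, Matrix.transpose_apply, Matrix.add_apply, Matrix.smul_apply,
    Matrix.smul_apply, gramMatrix_apply, gramMatrix_apply]
  rcases exists_index a i with ⟨l', hl'⟩ | ⟨ha, hi⟩ <;>
    rcases exists_index a j with ⟨l, hl⟩ | ⟨ha', hj⟩
  · rw [mul_gramMatrix_apply _ a hl, mul_gramMatrix_apply _ a hl']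
    by_cases hil : (i : ℕ) + 1 = l
    · have hjl : (j : ℕ) + 1 = l' := by omega
      -- The coefficients of ξ₃ at i and j add up to i + j + 3 - m = a. So the contribution vanishes
      -- for the form of f, and for the form of e it is t times the form of f, matching ξ₃ on the
      -- centre.
      have e : (i : k) + j + 3 = m + ((a : ℕ) : k) := by
        have : (i : ℕ) + j + 3 = m + a := by omega
        exact_mod_cast congrArg (Nat.cast : ℕ → k) this
      fin_cases a
      · have h0 : ¬ ((i : ℕ) + j + 2 = m) := by simp at hl; omega
        simp at e
        fin_cases α <;> fin_cases β <;> simp [hil, hjl, h0]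
        · linear_combination t * e
        · linear_combination -t * e
      · have h0 : (i : ℕ) + j + 2 = m := by simp at hl; omega
        simp at e
        fin_cases α <;> fin_cases β <;> simp [hil, hjl, h0, symplecticBlock]
        · linear_combination t * e
        · linear_combination -t * e
    · have hjl : ¬ (j : ℕ) + 1 = l' := by omega
      fin_cases a
      · fin_cases α <;> fin_cases β <;> simp [hil, hjl]
      · have h0 : ¬ (i : ℕ) + j + 2 = m := by simp at hl; omega
        fin_cases α <;> fin_cases β <;> simp [hil, hjl, h0]
  · subst ha'
    rw [mul_gramMatrix_zero_apply _ hj, mul_gramMatrix_apply _ 0 hl']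
    have hjl : ¬ (j : ℕ) + 1 = l' := by omega
    simp [hjl]
  · subst ha
    rw [mul_gramMatrix_zero_apply _ hi, mul_gramMatrix_apply _ 0 hl]
    have hil : ¬ (i : ℕ) + 1 = l := by omega
    simp [hil]
  · subst ha
    rw [mul_gramMatrix_zero_apply _ hi, mul_gramMatrix_zero_apply _ hj]
    simp

end Derivation

/-! ### Generation of the unipotent radical -/

section Generation

variable {m : ℕ} {k : Type u} [Field k]

/-- The block matrix with `V` on the `d`-th block superdiagonal. -/
def superdiagonal (m d : ℕ) (V : Matrix (Fin 2) (Fin 2) k) :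
    Matrix ((Fin m × Fin 2) ⊕ Fin 2) ((Fin m × Fin 2) ⊕ Fin 2) k :=
  Matrix.fromBlocks ((Matrix.of fun i j : Fin m => if (i : ℕ) + d = j then (1 : k) else 0) ⊗ₖ V)
    0 0 0

theorem superdiagonal_mem_nilpotentSet {d : ℕ} (hd : 1 ≤ d) {V : Matrix (Fin 2) (Fin 2) k}
    (hV : V.trace = 0) : superdiagonal m d V ∈ nilpotentSet m k := by
  refine ⟨fun e => if e = d then V else 0, 0, fun e => ?_, ?_⟩
  · simp only []
    split_ifs
    · exact hV
    · exact Matrix.trace_zero _ _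
  · rw [superdiagonal]
    congr 1
    ext ⟨i, α⟩ ⟨j, β⟩
    simp only [Matrix.kroneckerMap_apply, Matrix.of_apply, Fin.lt_def]
    by_cases h : (i : ℕ) + d = j
    · have h1 : (i : ℕ) < j := by omega
      have h2 : (j : ℕ) - i = d := by omega
      simp [h, h1, h2]
    · have h2 : (i : ℕ) < j → ¬ ((j : ℕ) - i = d) := by omega
      by_cases h1 : (i : ℕ) < j
      · simp [h, h1, h2 h1]
      · simp [h, h1]

theorem mul_superdiagonal_inl {d : ℕ} (V : Matrix (Fin 2) (Fin 2) k)
    (M : Matrix ((Fin m × Fin 2) ⊕ Fin 2) ((Fin m × Fin 2) ⊕ Fin 2) k)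
    (p : (Fin m × Fin 2) ⊕ Fin 2) {l j : Fin m} (h : (l : ℕ) + d = j) (β : Fin 2) :
    (M * superdiagonal m d V) p (Sum.inl (j, β)) = ∑ γ, M p (Sum.inl (l, γ)) * V γ β := by
  rw [Matrix.mul_apply, Fintype.sum_sum_type, Fintype.sum_prod_type, Finset.sum_eq_single l]
  · simp [superdiagonal, Matrix.kroneckerMap_apply, h]
  · intro i _ hi
    have : ¬ (i : ℕ) + d = j := fun h' => hi (Fin.ext (by omega))
    simp [superdiagonal, Matrix.kroneckerMap_apply, this]
  · simp

theorem mul_superdiagonal_inl_of_lt {d : ℕ} (V : Matrix (Fin 2) (Fin 2) k)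
    (M : Matrix ((Fin m × Fin 2) ⊕ Fin 2) ((Fin m × Fin 2) ⊕ Fin 2) k)
    (p : (Fin m × Fin 2) ⊕ Fin 2) {j : Fin m} (h : (j : ℕ) < d) (β : Fin 2) :
    (M * superdiagonal m d V) p (Sum.inl (j, β)) = 0 := by
  rw [Matrix.mul_apply, Fintype.sum_sum_type, Fintype.sum_prod_type]
  have : ∀ i : Fin m, ¬ (i : ℕ) + d = j := fun i => by omega
  simp [superdiagonal, Matrix.kroneckerMap_apply, this]

theorem mul_superdiagonal_inr {d : ℕ} (V : Matrix (Fin 2) (Fin 2) k)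
    (M : Matrix ((Fin m × Fin 2) ⊕ Fin 2) ((Fin m × Fin 2) ⊕ Fin 2) k)
    (p : (Fin m × Fin 2) ⊕ Fin 2) (b : Fin 2) :
    (M * superdiagonal m d V) p (Sum.inr b) = 0 := by
  rw [Matrix.mul_apply, Fintype.sum_sum_type]
  simp [superdiagonal]

variable [Algebra ℚ k]

theorem IsNilpotent.exp_of_mul_self {A : Type*} [Ring A] [Module ℚ A] {a : A} (h : a * a = 0) :
    IsNilpotent.exp a = 1 + a := by
  rw [IsNilpotent.exp_eq_sum (k := 2) (by rw [sq, h])]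
  simp [Finset.sum_range_succ]

theorem exists_mem_closure_val_eq_exp
    {M : Matrix ((Fin m × Fin 2) ⊕ Fin 2) ((Fin m × Fin 2) ⊕ Fin 2) k} (hn : IsNilpotent M)
    (hM : M ∈ nilpotentSet m k ∨ ∃ t : k, M = t • (xiThree m).map (algebraMap ℚ k)) :
    ∃ e ∈ Subgroup.closure (unipotentGenerators m k), e.val = IsNilpotent.exp M := by
  obtain ⟨e, he⟩ := IsNilpotent.isUnit_exp hn
  refine ⟨e, Subgroup.subset_closure ?_, he⟩
  rcases hM with hM | ⟨t, rfl⟩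
  · exact Or.inl ⟨M, hM, he⟩
  · exact Or.inr ⟨t, he⟩

variable (m k) in
theorem closure_unipotentGenerators_le (hm : 1 ≤ m) :
    Subgroup.closure (unipotentGenerators m k) ≤ unipotentPoints m k hm := by
  rw [Subgroup.closure_le]
  rintro g (⟨M, hM, hg⟩ | ⟨t, hg⟩)
  · exact exp_mem_of_nilpotentSet hm hM hg
  · exact exp_mem_of_xiThree hm hg

/-- Square-zero blocks V are used because the exponential is then linear in V. -/
theorem exists_mem_closure_val_eq_superdiagonal {d : ℕ} (hd : 1 ≤ d) {V : Matrix (Fin 2) (Fin 2) k}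
    (hV : V.trace = 0) (hVV : V * V = 0) :
    ∃ e ∈ Subgroup.closure (unipotentGenerators m k), e.val = 1 + superdiagonal m d V := by
  have h : superdiagonal m d V * superdiagonal m d V = 0 := by
    rw [superdiagonal, Matrix.fromBlocks_multiply, ← Matrix.mul_kronecker_mul, hVV]
    simp
  rw [← IsNilpotent.exp_of_mul_self h]
  exact exists_mem_closure_val_eq_exp ⟨2, by rw [sq, h]⟩
    (Or.inl (superdiagonal_mem_nilpotentSet hd hV))

theorem unipotentPoints_apply {hm : 1 ≤ m} {n : GL ((Fin m × Fin 2) ⊕ Fin 2) k}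
    (hn : n ∈ unipotentPoints m k hm) {p q : (Fin m × Fin 2) ⊕ Fin 2}
    (h : basisDegree m q ≤ basisDegree m p) : n.val p q = (1 : Matrix _ _ k) p q :=
  sub_eq_zero.1 (hn.2 p q h)

/-- The relations satisfied by a block unitriangular automorphism that fixes the centre. -/
theorem conj_gramMatrix_of_mem {hm : 1 ≤ m} {n : GL ((Fin m × Fin 2) ⊕ Fin 2) k}
    (hn : n ∈ unipotentPoints m k hm) (hc : n.val (Sum.inr 0) (Sum.inr 1) = 0) (a : Fin 2) :
    n.val.toBlocks₁₁ * gramMatrix m k a * n.val.toBlocks₁₁ᵀ = gramMatrix m k a := by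
  rw [((mem_autGroup_iff m k n).1 hn.1).2 a]
  have e00 : n.val (Sum.inr 0) (Sum.inr 0) = 1 := by
    rw [unipotentPoints_apply hn le_rfl, Matrix.one_apply_eq]
  have e11 : n.val (Sum.inr 1) (Sum.inr 1) = 1 := by
    rw [unipotentPoints_apply hn le_rfl, Matrix.one_apply_eq]
  have e10 : n.val (Sum.inr 1) (Sum.inr 0) = 0 := by
    rw [unipotentPoints_apply hn (by simp [basisDegree])]
    simp
  fin_cases a <;> simp [Matrix.toBlocks₂₂, e00, e11, e10, hc]

/-- Once the centre is fixed, a = d = 1 and c = 0, and the shift relation says that T commutes with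
J. The first block row then determines T. -/
theorem toeplitz_of_mem {hm : 1 ≤ m} {n : GL ((Fin m × Fin 2) ⊕ Fin 2) k}
    (hn : n ∈ unipotentPoints m k hm) (hc : n.val (Sum.inr 0) (Sum.inr 1) = 0) {d : Fin m} :
    ∀ (l : ℕ) (i j : Fin m), (i : ℕ) = l → (i : ℕ) + d = j → ∀ α β,
      n.val (Sum.inl (i, α)) (Sum.inl (j, β)) = n.val (Sum.inl (⟨0, hm⟩, α)) (Sum.inl (d, β)) := by
  have hT : IsUnit n.val.toBlocks₁₁.det := by
    have h := congrArg Matrix.det (conj_gramMatrix_of_mem hn hc 1)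
    rw [Matrix.det_mul, Matrix.det_mul] at h
    have := isUnit_det_gramMatrix_one (m := m) (R := k)
    rw [← h, mul_assoc] at this
    exact isUnit_of_mul_isUnit_left this
  have hrel := shift_relation (a := 1) (c := 0) (d := 1) isUnit_one hT
    (by rw [one_smul]; exact conj_gramMatrix_of_mem hn hc 0)
    (by rw [one_smul, zero_smul, zero_add]; exact conj_gramMatrix_of_mem hn hc 1)
  intro l
  induction l with
  | zero =>
    intro i j hi hj α β
    have h1 : i = ⟨0, hm⟩ := Fin.ext hi
    have h2 : j = d := Fin.ext (by omega)
    rw [h1, h2]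
  | succ l ih =>
    intro i j hi hj α β
    rw [← ih ⟨l, by omega⟩ ⟨j - 1, by omega⟩ rfl (by simp only; omega)]
    have := shift_relation_apply hrel (i := ⟨l, by omega⟩) (i' := i) (j := ⟨j - 1, by omega⟩)
      (j' := j) hi.symm (by simp only; omega) α β
    rw [one_mul, zero_mul, add_zero, one_mul] at this
    exact this.symm

/-- A block unitriangular automorphism fixing the centre whose upper left part agrees with the
identity below the `d`-th block superdiagonal. -/
structure IsUnipotentOfDepth (hm : 1 ≤ m) (d : ℕ) (n : GL ((Fin m × Fin 2) ⊕ Fin 2) k) : Prop where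
  mem : n ∈ unipotentPoints m k hm
  center : n.val (Sum.inr 0) (Sum.inr 1) = 0
  row : ∀ j : Fin m, 1 ≤ (j : ℕ) → (j : ℕ) < d → ∀ α β,
    n.val (Sum.inl (⟨0, hm⟩, α)) (Sum.inl (j, β)) = 0

/-- In the chosen entry of T P_e Tᵗ = P_e only the summands k = 0 and k = d survive: those between
vanish by the depth, those beyond by triangularity. The Toeplitz property turns both into diagonal
entries of the same block. -/
theorem IsUnipotentOfDepth.trace {hm : 1 ≤ m} {d : Fin m} (hd : 1 ≤ (d : ℕ))
    {n : GL ((Fin m × Fin 2) ⊕ Fin 2) k} (hn : IsUnipotentOfDepth hm d n) :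
    n.val (Sum.inl (⟨0, hm⟩, 0)) (Sum.inl (d, 0)) +
      n.val (Sum.inl (⟨0, hm⟩, 1)) (Sum.inl (d, 1)) = 0 := by
  have h := congrFun (congrFun (conj_gramMatrix_of_mem hn.mem hn.center 1) (⟨0, hm⟩, 0)) (d.rev, 1)
  rw [mul_gramMatrix_one_mul_transpose_apply] at h
  have hzero : ∀ i j : Fin m, j < i → ∀ α β, n.val (Sum.inl (i, α)) (Sum.inl (j, β)) = 0 := by
    intro i j hij α β
    rw [unipotentPoints_apply hn.mem (p := Sum.inl (i, α)) (q := Sum.inl (j, β)) hij.le]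
    simp [hij.ne']
  have hone : ∀ (i : Fin m) α β, n.val (Sum.inl (i, α)) (Sum.inl (i, β)) =
      (1 : Matrix (Fin 2) (Fin 2) k) α β := by
    intro i α β
    rw [unipotentPoints_apply hn.mem (p := Sum.inl (i, α)) (q := Sum.inl (i, β)) le_rfl]
    simp [Matrix.one_apply]
  have h0d : (⟨0, hm⟩ : Fin m) ≠ d := fun h => by simp [← h] at hd
  rw [← Finset.sum_subset (Finset.subset_univ {⟨0, hm⟩, d}), Finset.sum_pair h0d] at h
  · have ht := toeplitz_of_mem hn.mem hn.center (d := d) _ d.rev (Fin.rev ⟨0, hm⟩) rfl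
      (by rw [Fin.val_rev, Fin.val_rev]; simp only; omega)
    have hg : ¬ (0 + (d.rev : ℕ) + 2 = m + 1) := by rw [Fin.val_rev]; omega
    simp only [Matrix.toBlocks₁₁, Matrix.of_apply, hone, ht, gramMatrix_apply, Fin.val_one, hg,
      if_false] at h
    simp at h
    linear_combination h
  · intro j _ hj
    simp only [Finset.mem_insert, Finset.mem_singleton, not_or] at hj
    have hj0 : 1 ≤ (j : ℕ) := Nat.one_le_iff_ne_zero.2 fun h => hj.1 (Fin.ext h)
    simp only [Matrix.toBlocks₁₁, Matrix.of_apply]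
    rcases lt_or_gt_of_ne hj.2 with hlt | hlt
    · rw [hn.row j hj0 hlt, hn.row j hj0 hlt]; ring
    · have : j.rev < d.rev := Fin.rev_lt_rev.2 hlt
      rw [hzero _ _ this, hzero _ _ this]; ring

/-- Right multiplication by 1 + superdiagonal leaves the columns before d unchanged and adds V at
position d of the first row, since the leading block is 1. -/
theorem IsUnipotentOfDepth.mul_superdiagonal {hm : 1 ≤ m} {d : Fin m} (hd : 1 ≤ (d : ℕ))
    {n : GL ((Fin m × Fin 2) ⊕ Fin 2) k} (hn : IsUnipotentOfDepth hm d n)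
    {V : Matrix (Fin 2) (Fin 2) k} (hV : V.trace = 0) (hVV : V * V = 0) :
    ∃ e ∈ Subgroup.closure (unipotentGenerators m k), IsUnipotentOfDepth hm d (n * e) ∧
      ∀ α β, (n * e).val (Sum.inl (⟨0, hm⟩, α)) (Sum.inl (d, β)) =
        n.val (Sum.inl (⟨0, hm⟩, α)) (Sum.inl (d, β)) + V α β := by
  obtain ⟨e, he, hval⟩ := exists_mem_closure_val_eq_superdiagonal (m := m) hd hV hVV
  have hne : (n * e).val = n.val + n.val * superdiagonal m d V := by
    rw [Units.val_mul, hval, mul_add, mul_one]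
  refine ⟨e, he, ⟨mul_mem hn.mem (closure_unipotentGenerators_le m k hm he), ?_, ?_⟩, ?_⟩
  · rw [hne, Matrix.add_apply, mul_superdiagonal_inr, hn.center, add_zero]
  · intro j hj hjd α β
    rw [hne, Matrix.add_apply, mul_superdiagonal_inl_of_lt _ _ _ hjd, hn.row j hj hjd, add_zero]
  · intro α β
    rw [hne, Matrix.add_apply, mul_superdiagonal_inl (l := ⟨0, hm⟩) _ _ _ (by simp)]
    congr 1
    have : ∀ γ, n.val (Sum.inl (⟨0, hm⟩, α)) (Sum.inl (⟨0, hm⟩, γ)) =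
        (1 : Matrix (Fin 2) (Fin 2) k) α γ := by
      intro γ
      rw [unipotentPoints_apply hn.mem (p := Sum.inl (⟨0, hm⟩, α)) (q := Sum.inl (⟨0, hm⟩, γ)) le_rfl]
      simp [Matrix.one_apply]
    simp only [this]
    rw [← Matrix.mul_apply, one_mul]

theorem IsUnipotentOfDepth.exists_succ {hm : 1 ≤ m} {d : Fin m} (hd : 1 ≤ (d : ℕ))
    {n : GL ((Fin m × Fin 2) ⊕ Fin 2) k} (hn : IsUnipotentOfDepth hm d n) :
    ∃ e ∈ Subgroup.closure (unipotentGenerators m k), IsUnipotentOfDepth hm (d + 1) (n * e) := by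
  have htr := hn.trace hd
  set x := n.val (Sum.inl (⟨0, hm⟩, 0)) (Sum.inl (d, 0)) with hx
  set y := n.val (Sum.inl (⟨0, hm⟩, 0)) (Sum.inl (d, 1)) with hy
  set z := n.val (Sum.inl (⟨0, hm⟩, 1)) (Sum.inl (d, 0)) with hz
  -- The traceless block to be cancelled has rows (x, y) and (z, -x). Its negative is the sum of
  -- this square-zero matrix, which takes care of the diagonal, and of two strictly triangular
  -- corrections.
  obtain ⟨e₁, he₁, hn₁, h₁⟩ := hn.mul_superdiagonal hd (V := !![-x, x; -x, x])
    (by simp [Matrix.trace_fin_two])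
    (by ext i j; fin_cases i <;> fin_cases j <;> simp)
  obtain ⟨e₂, he₂, hn₂, h₂⟩ := hn₁.mul_superdiagonal hd (V := !![0, -(x + y); 0, 0])
    (by simp [Matrix.trace_fin_two])
    (by ext i j; fin_cases i <;> fin_cases j <;> simp)
  obtain ⟨e₃, he₃, hn₃, h₃⟩ := hn₂.mul_superdiagonal hd (V := !![0, 0; x - z, 0])
    (by simp [Matrix.trace_fin_two])
    (by ext i j; fin_cases i <;> fin_cases j <;> simp)
  refine ⟨e₁ * e₂ * e₃, mul_mem (mul_mem he₁ he₂) he₃, ?_⟩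
  rw [← mul_assoc, ← mul_assoc]
  refine ⟨hn₃.mem, hn₃.center, fun j hj hjd α β => ?_⟩
  rcases (Nat.lt_succ_iff_lt_or_eq.1 hjd) with hlt | heq
  · exact hn₃.row j hj hlt α β
  · rw [Fin.ext heq, h₃, h₂, h₁]
    fin_cases α <;> fin_cases β
    · simp [← hx]
    · simp [← hy]; ring
    · simp [← hz]; ring
    · simp; linear_combination htr

/-- At depth m only the block Z is left, and 1 + Z is the exponential of an element of 𝔫₀ with all X
equal to zero. -/
theorem IsUnipotentOfDepth.mem_closure {hm : 1 ≤ m} {n : GL ((Fin m × Fin 2) ⊕ Fin 2) k}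
    (hn : IsUnipotentOfDepth hm m n) : n ∈ Subgroup.closure (unipotentGenerators m k) := by
  have hT : ∀ p q, n.val (Sum.inl p) (Sum.inl q) =
      (1 : Matrix (Fin m × Fin 2) (Fin m × Fin 2) k) p q := by
    rintro ⟨i, α⟩ ⟨j, β⟩
    rcases le_or_gt j i with hij | hij
    · rw [unipotentPoints_apply hn.mem (p := Sum.inl (i, α)) (q := Sum.inl (j, β)) hij]
      simp [Matrix.one_apply]
    · have hij' : (i : ℕ) < j := hij
      rw [toeplitz_of_mem hn.mem hn.center (d := ⟨j - i, by omega⟩) _ i j rfl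
        (by simp only; omega), hn.row _ (by simp only; omega) (by simp only; omega)]
      rw [Matrix.one_apply_ne]
      rintro h
      exact hij.ne (congrArg Prod.fst h)
  set M : Matrix ((Fin m × Fin 2) ⊕ Fin 2) ((Fin m × Fin 2) ⊕ Fin 2) k :=
    Matrix.fromBlocks 0 n.val.toBlocks₁₂ 0 0 with hM
  have hMM : M * M = 0 := by rw [hM, Matrix.fromBlocks_multiply]; simp
  refine Subgroup.subset_closure (Or.inl ⟨M, ⟨fun _ => 0, n.val.toBlocks₁₂, by simp, ?_⟩, ?_⟩)
  · rw [hM]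
    congr 1
    ext; simp
  · rw [IsNilpotent.exp_of_mul_self hMM]
    ext (p | a) (q | b)
    · rw [hT]; simp [hM, Matrix.one_apply]
    · simp [hM, Matrix.toBlocks₁₂]
    · rw [unipotentPoints_apply hn.mem (by simp [basisDegree]; omega)]; simp [hM]
    · rcases eq_or_ne (a, b) (0, 1) with h | h
      · obtain ⟨rfl, rfl⟩ := Prod.mk.inj h
        rw [hn.center]; simp [hM]
      · have : (b : ℕ) ≤ a := by
          revert h
          fin_cases a <;> fin_cases b <;> simp
        rw [unipotentPoints_apply hn.mem (by simpa [basisDegree] using this)]; simp [hM]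

theorem IsUnipotentOfDepth.mem_closure_of_add {hm : 1 ≤ m} (c : ℕ) :
    ∀ {d : ℕ}, 1 ≤ d → d + c = m → ∀ {n : GL ((Fin m × Fin 2) ⊕ Fin 2) k},
      IsUnipotentOfDepth hm d n → n ∈ Subgroup.closure (unipotentGenerators m k) := by
  induction c with
  | zero =>
    rintro d - rfl n hn
    exact hn.mem_closure
  | succ c ih =>
    intro d hd hdc n hn
    obtain ⟨e, he, hne⟩ := IsUnipotentOfDepth.exists_succ (d := ⟨d, by omega⟩) hd hn
    exact (Subgroup.mul_mem_cancel_right _ he).1 (ih (by omega) (by simp only; omega) hne)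

/-- On the centre ξ₃ has square zero, so only the linear term contributes. -/
theorem exp_smul_xiThree_apply (t : k) :
    IsNilpotent.exp (t • (xiThree m).map (algebraMap ℚ k)) (Sum.inr 0) (Sum.inr 1) = t := by
  obtain ⟨N, hN⟩ := (isStrictlyTriangular_smul_xiThree (m := m) t).isNilpotent
  rw [IsNilpotent.exp_eq_sum (k := N + 2) (pow_eq_zero_of_le (by omega) hN),
    Finset.sum_range_succ', Finset.sum_range_succ']
  set D := t • (xiThree m).map (algebraMap ℚ k) with hD
  have h1 : ∀ (M : Matrix ((Fin m × Fin 2) ⊕ Fin 2) ((Fin m × Fin 2) ⊕ Fin 2) k) q,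
      (D * M) (Sum.inr 0) q = t * M (Sum.inr 1) q := by
    intro M q
    rw [hD, smul_map_xiThree, Matrix.mul_apply, Fintype.sum_sum_type, Fin.sum_univ_two]
    simp
  have h2 : ∀ (M : Matrix ((Fin m × Fin 2) ⊕ Fin 2) ((Fin m × Fin 2) ⊕ Fin 2) k) q,
      (D * M) (Sum.inr 1) q = 0 := by
    intro M q
    rw [hD, smul_map_xiThree, Matrix.mul_apply, Fintype.sum_sum_type, Fin.sum_univ_two]
    simp
  have h3 : ∀ i, (D ^ (i + 1 + 1)) (Sum.inr 0) (Sum.inr 1) = 0 := by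
    intro i
    rw [pow_succ', h1, pow_succ', h2, mul_zero]
  have h4 : D (Sum.inr 0) (Sum.inr 1) = t := by
    rw [hD, smul_map_xiThree]; simp
  simp only [Matrix.add_apply, Matrix.sum_apply, Matrix.smul_apply, h3]
  rw [Finset.sum_eq_zero fun n _ => by simp]
  simp [h4]

theorem unipotentPoints_eq_closure (hm : 1 ≤ m) :
    unipotentPoints m k hm = Subgroup.closure (unipotentGenerators m k) := by
  refine le_antisymm (fun n hn => ?_) (closure_unipotentGenerators_le m k hm)
  obtain ⟨e, he, hval⟩ := exists_mem_closure_val_eq_exp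
    (isStrictlyTriangular_smul_xiThree (m := m) (-n.val (Sum.inr 0) (Sum.inr 1))).isNilpotent
    (Or.inr ⟨_, rfl⟩)
  have heN := closure_unipotentGenerators_le m k hm he
  -- The factor e was chosen to cancel the entry from f to e. Depth 1 imposes no condition on the
  -- first row, so m - 1 rounds of cancellation remain.
  refine (Subgroup.mul_mem_cancel_right _ he).1
    (IsUnipotentOfDepth.mem_closure_of_add (m - 1) le_rfl (by omega)
      ⟨mul_mem hn heN, ?_, fun j hj hjd => by omega⟩)
  have h1 : ∀ q, n.val (Sum.inr 0) (Sum.inl q) = 0 := fun q => by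
    rw [unipotentPoints_apply hn (by simp [basisDegree])]; simp
  have h2 : n.val (Sum.inr 0) (Sum.inr 0) = 1 := by
    rw [unipotentPoints_apply hn le_rfl, Matrix.one_apply_eq]
  have h3 : e.val (Sum.inr 1) (Sum.inr 1) = 1 := by
    rw [unipotentPoints_apply heN le_rfl, Matrix.one_apply_eq]
  have h4 : e.val (Sum.inr 0) (Sum.inr 1) = -n.val (Sum.inr 0) (Sum.inr 1) := by
    rw [hval, exp_smul_xiThree_apply]
  rw [Units.val_mul, Matrix.mul_apply, Fintype.sum_sum_type, Fin.sum_univ_two, h2, h3, h4]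
  simp [h1]

end Generation

theorem mainTheorem5 (m : ℕ) (hm : 1 ≤ m) :
    ∃ G₀ N H : AlgSubgroup.{u} ((Fin m × Fin 2) ⊕ Fin 2),
      AlgSubgroup.IsIdentityComponent
        (algebraicAutGroup (DStarLieAlgebra.basisC m (Polynomial.X ^ m))) G₀ ∧
      AlgSubgroup.IsUnipotentRadical G₀ N ∧
      AlgSubgroup.IsReductive H ∧
      AlgSubgroup.IsSemidirectProduct G₀ N H ∧
      (∃ Φ : AlgSubgroup.IsoGLTwoGLOne H,
        ∀ (R : Type u) [CommRing R] [Algebra ℚ R] (A : GL (Fin 2) R) (μ : Rˣ),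
          (Φ.equiv R (A, μ) : GL ((Fin m × Fin 2) ⊕ Fin 2) R).val =
            reductiveMatrix m A.val (μ : R)) ∧
      ∀ (k : Type u) [Field k] [Algebra ℚ k],
        N.pts k = Subgroup.closure (unipotentGenerators m k) := by
  exact ⟨algebraicAutGroup (DStarLieAlgebra.basisC m (Polynomial.X ^ m)), unipotentGroup m hm,
    reductiveGroup m hm, isIdentityComponent_autGroup m hm, isUnipotentRadical_autGroup m hm,
    isReductive_reductiveGroup m hm, isSemidirectProduct_autGroup m hm,
    ⟨reductiveIso m hm, fun _ _ _ _ _ => rfl⟩, fun _ _ _ => unipotentPoints_eq_closure hm⟩
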